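/- Let $\mu$ be a probability measure on $\mathbb Z$ with $\mu(\{1,2,3,\dots\})>0$ and $\gcd(\operatorname{supp}\mu)=1$, and let $(Y_n)_{n\ge 0}$ be i.i.d. random variables with law $\mu$. Reflected random walk on $\mathbb N_0=\{0,1,2,\dots\}$ started at $x\in\mathbb N_0$ is $X_0^x=x$, $X_n^x=|X_{n-1}^x-Y_n|$. Let $S_k=Y_1+\dots+Y_k$, let $t(0)=0$ and $t(n)=\inf\{k>t(n-1): S_k \text{ is even}\}$ (these times are a.s. finite), and consider the induced process $(X_{t(n)}^x)_{n\ge0}$, which a.s. stays in the parity class $C_0=2\mathbb N_0$ or $C_1=2\mathbb N_0+1$ of $x$. It is generated by i.i.d. maps with the same law $\tilde\mu_t$ as the random map $F_1: x\mapsto X_{t(1)}^x$ of $\mathbb N_0$ into itself (with the topology of pointwise convergence on the space of such maps). Put $N=\sup\operatorname{supp}\mu$ if $\operatorname{supp}\mu\subset\mathbb N_0$ and $N=\infty$ otherwise, and $L=\{x\in\mathbb N_0: x\le N\}$. Then the following holds. (1) For each $i\in\{0,1\}$ the induced process is locally contractive on $C_i$: for every $x\in C_i$ and every compact (that is, finite)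 $K\subset C_i$, almost surely $|X_{t(n)}^x-X_{t(n)}^y|\cdot\mathbf 1_K(X_{t(n)}^x)\to0$ for all $y\in C_i$. (2) For each $i\in\{0,1\}$ the limit set of the induced process on $C_i$ is $L_i=L\cap C_i$. This means: $L_i$ is the smallest non-empty (closed) subset of $C_i$ that is mapped into itself by every $f\in\operatorname{supp}\tilde\mu_t$; and unless the induced process is transient on $C_i$ (that is, $X_{t(n)}^x\to\infty$ a.s. for every $x\in C_i$), $L_i$ is the largest non-empty (closed) subset $A$ of $C_i$ such that every set $U$ that intersects $A$ is a.s. visited infinitely often by $(X_{t(n)}^x)$ for every $x\in C_i$, and, for every $x\in C_i$, $L_i$ is a.s. the set of accumulation points of $(X_{t(n)}^x)_{n\ge0}$. (3) If $(X_n^x)$ is positive recurrent on $L$ (for each starting point $x\in L$ the return time to $x$ is a.s. finite and has finite expectation), then the induced process is positive recurrent on each of $L_0$ and $L_1$. If $(X_n^x)$ is null recurrent on $L$ (for each starting point $x\in L$ the return time to $x$ is a.s. finite and has infinite expectation), then the induced process is null recurrent on each of $L_0$ and $L_1$. (4) If $(X_n^x)$ is recurrent on $L$ (positive or null), then $X_n^x-X_n^y\to0$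 almost surely for all $x,y\in\mathbb N_0$ such that $x-y$ is even. -/

import Mathlib

open MeasureTheory ProbabilityTheory Filter Topology Set
open scoped ENNReal

namespace ReflectedWalk

section General

variable {Ω 𝕏 : Type*} [MeasurableSpace Ω]

/-! A stochastic dynamical system is given through its flow `X : 𝕏 → ℕ → Ω → 𝕏`, where
`X x n ω` is the position at time `n` of the trajectory that starts at `x`. All trajectories
are driven by the same randomness `ω`. `C ⊆ 𝕏` is the part of `𝕏` that serves as state space. -/

/-- Local contractivity on the state space `C`: for all `x ∈ C` and all compact `K ⊆ C`, almost
surely `d(Xₙˣ, Xₙʸ) · 1_K(Xₙˣ) → 0` for all `y ∈ C` simultaneously. -/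
def LocallyContractiveOn [MetricSpace 𝕏] (P : Measure Ω) (X : 𝕏 → ℕ → Ω → 𝕏) (C : Set 𝕏) : Prop :=
  ∀ x ∈ C, ∀ K ⊆ C, IsCompact K → ∀ᵐ ω ∂P, ∀ y ∈ C,
    Tendsto (fun n => dist (X x n ω) (X y n ω) * K.indicator (fun _ => (1 : ℝ)) (X x n ω))
      atTop (𝓝 0)

/-- Transience on the state space `C`: `d(Xₙˣ, x) → ∞` almost surely, for every `x ∈ C`. -/
def TransientOn [MetricSpace 𝕏] (P : Measure Ω) (X : 𝕏 → ℕ → Ω → 𝕏) (C : Set 𝕏) : Prop :=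
  ∀ x ∈ C, ∀ᵐ ω ∂P, Tendsto (fun n => dist (X x n ω) x) atTop atTop

/-- `A` is a non-empty closed subset of `C` such that every open set that intersects `A` is
almost surely visited infinitely often, from every starting point in `C`. -/
def IsRecurrentSet [TopologicalSpace 𝕏] (P : Measure Ω) (X : 𝕏 → ℕ → Ω → 𝕏) (C A : Set 𝕏) :
    Prop :=
  A ⊆ C ∧ A.Nonempty ∧ IsClosed A ∧
    ∀ U : Set 𝕏, IsOpen U → (U ∩ A).Nonempty →
      ∀ x ∈ C, ∀ᵐ ω ∂P, ∃ᶠ n in atTop, X x n ω ∈ U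

/-- `L` is the attractor on the state space `C`: it is the greatest recurrent set, and it is
almost surely the set of accumulation points of each trajectory that starts in `C`. -/
def IsAttractor [TopologicalSpace 𝕏] (P : Measure Ω) (X : 𝕏 → ℕ → Ω → 𝕏) (C L : Set 𝕏) : Prop :=
  IsGreatest {A | IsRecurrentSet P X C A} L ∧
    ∀ x ∈ C, ∀ᵐ ω ∂P, {z | MapClusterPt z atTop (fun n => X x n ω)} = L

/-- `L` is the smallest non-empty closed subset of `C` that is mapped into itself by every map
in the support of `μt`, the law on `𝕏 → 𝕏` of the i.i.d. maps that generate the system. -/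
def IsLeastInvariant [TopologicalSpace 𝕏] [MeasurableSpace 𝕏] (μt : Measure (𝕏 → 𝕏))
    (C L : Set 𝕏) : Prop :=
  IsLeast {A | A ⊆ C ∧ A.Nonempty ∧ IsClosed A ∧ ∀ f ∈ μt.support, MapsTo f A A} L

/-- The first time `n ≥ 1` at which the trajectory `Z` is in `x` (`⊤` if there is none). -/
noncomputable def returnTime (Z : ℕ → 𝕏) (x : 𝕏) : ℕ∞ :=
  ⨅ n ∈ {n : ℕ | 1 ≤ n ∧ Z n = x}, (n : ℕ∞)

/-- Every state in `L` is recurrent: the return time to it is almost surely finite. -/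
def RecurrentOn (P : Measure Ω) (X : 𝕏 → ℕ → Ω → 𝕏) (L : Set 𝕏) : Prop :=
  ∀ x ∈ L, ∀ᵐ ω ∂P, returnTime (fun n => X x n ω) x < ⊤

/-- Every state in `L` is recurrent, with return time of finite expectation. -/
def PositiveRecurrentOn (P : Measure Ω) (X : 𝕏 → ℕ → Ω → 𝕏) (L : Set 𝕏) : Prop :=
  RecurrentOn P X L ∧
    ∀ x ∈ L, ∫⁻ ω, (returnTime (fun n => X x n ω) x : ℝ≥0∞) ∂P < ∞

/-- Every state in `L` is recurrent, with return time of infinite expectation. -/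
def NullRecurrentOn (P : Measure Ω) (X : 𝕏 → ℕ → Ω → 𝕏) (L : Set 𝕏) : Prop :=
  RecurrentOn P X L ∧
    ∀ x ∈ L, ∫⁻ ω, (returnTime (fun n => X x n ω) x : ℝ≥0∞) ∂P = ∞

end General

section Walk

variable {Ω : Type*}

/-- Reflected random walk on the non-negative integers:
`X₀ˣ = x` and `Xₙˣ = |Xₙ₋₁ˣ - Yₙ|`. (`Y₀` is not used.) -/
def walk (Y : ℕ → Ω → ℤ) (x : ℕ) : ℕ → Ω → ℕ
  | 0, _ => x
  | n + 1, ω => ((walk Y x n ω : ℤ) - Y (n + 1) ω).natAbs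

/-- The partial sums `Sₙ = Y₁ + ⋯ + Yₙ`. -/
def partialSum (Y : ℕ → Ω → ℤ) (n : ℕ) (ω : Ω) : ℤ :=
  ∑ k ∈ Finset.Icc 1 n, Y k ω

/-- The successive times at which `Sₖ` is even: `t(0) = 0` and
`t(n) = inf {k > t(n-1) : Sₖ is even}`. (Where there is no such `k`, which in the situation of
interest happens with probability `0`, the value is `0`.) -/
noncomputable def evenTime (Y : ℕ → Ω → ℤ) : ℕ → Ω → ℕ
  | 0, _ => 0
  | n + 1, ω => sInf {k : ℕ | evenTime Y n ω < k ∧ Even (partialSum Y k ω)}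

/-- The induced process `n ↦ X_{t(n)}ˣ`. -/
noncomputable def inducedWalk (Y : ℕ → Ω → ℤ) (x : ℕ) (n : ℕ) (ω : Ω) : ℕ :=
  walk Y x (evenTime Y n ω) ω

/-- The law on `ℕ → ℕ` (topology and σ-algebra of pointwise convergence) of the random map
`F₁ = f_{Y_{t(1)}} ∘ ⋯ ∘ f_{Y₁}`, `f_y(x) = |x - y|`, that is, of `x ↦ X_{t(1)}ˣ`. -/
noncomputable def inducedLaw [MeasurableSpace Ω] (P : Measure Ω) (Y : ℕ → Ω → ℤ) :
    Measure (ℕ → ℕ) :=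
  P.map (fun ω x => inducedWalk Y x 1 ω)

open Classical in
/-- `N = sup supp(μ)` if `supp(μ)` is contained in the non-negative integers, and `N = ∞`
otherwise. -/
noncomputable def supSupport (μ : Measure ℤ) : ℕ∞ :=
  if ∀ k ∈ μ.support, 0 ≤ k then ⨆ k ∈ μ.support, (k.toNat : ℕ∞) else ⊤

/-- The essential class `L = {x : 0 ≤ x ≤ N}` (all non-negative integers if `N = ∞`). -/
def essentialClass (μ : Measure ℤ) : Set ℕ :=
  {x | (x : ℕ∞) ≤ supSupport μ}

/-- The class of the even (`i = 0`), resp. odd (`i = 1`) non-negative integers. -/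
def parityClass (i : Fin 2) : Set ℕ :=
  {x | x % 2 = i}

end Walk

end ReflectedWalk

/-! Trajectories driven by the same steps never move apart, because `x ↦ |x - s|` is 1-Lipschitz.
The combinatorial core is that two distinct points of equal parity can be brought strictly closer by
a finite word of steps from the support. Write the pair as `|p|`, `|p + d|`. While `p ≥ 0` or `p ≤
-d`, a step `s` merely translates `p` by `-s` or `s`; if `-d < p < 0`, the gap is already smaller
than `d`. A positive step `y` reduces `p` modulo `y`, and gcd 1 makes every residue accessible
(`Moves.of_lt`). From `y - 1` the step `y` leads to `-1`, which lies strictly between `-d` and `0`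
since `d ≥ 2`. With `d = 0` the same moves show that every point of the essential class is
accessible from everywhere (`IsAdmissible.exists_run_eq`).

Lévy's zero-one law (`frequently_and_shift_mem`) turns accessibility into infinitely many
occurrences. If a trajectory visits `z` infinitely often, the bounded gap makes some pair `(z, v)`
recur, and `z ≠ v` would let the gap shrink between two visits to the same pair; so trajectories of
equal parity coalesce (`IsStepSequence.ae_coalesce`). Since a trajectory is in its own parity class
exactly at the even times, contractivity and the attractor of the induced process, and the
convergence in the recurrent case, follow.

The induced process returns no later, in its own clock, than the walk. Conversely, from an odd
partial sum the next one is even with probability bounded below, so the mean return time of the walk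
is at most a constant times that of the induced process; this gives null recurrence. -/

namespace ReflectedWalk

/-! ### Words of steps: accessibility and contraction of pairs -/

/-- One step of reflected random walk. -/
def reflect (x : ℕ) (s : ℤ) : ℕ := ((x : ℤ) - s).natAbs

/-- The position reached from `x` after the steps listed in `w`. -/
def run (x : ℕ) (w : List ℤ) : ℕ := w.foldl reflect x

@[simp] lemma run_nil (x : ℕ) : run x [] = x := rfl

@[simp] lemma run_cons (x : ℕ) (s : ℤ) (w : List ℤ) : run x (s :: w) = run (reflect x s) w := rfl

lemma run_append (x : ℕ) (v w : List ℤ) : run x (v ++ w) = run (run x v) w := by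
  simp [run]

lemma abs_reflect_sub_le (x y : ℕ) (s : ℤ) :
    |(reflect x s : ℤ) - reflect y s| ≤ |(x : ℤ) - y| := by
  unfold reflect
  grind

lemma abs_run_sub_le (w : List ℤ) (x y : ℕ) : |(run x w : ℤ) - run y w| ≤ |(x : ℤ) - y| := by
  induction w generalizing x y with
  | nil => simp
  | cons s w ih => exact (ih _ _).trans (abs_reflect_sub_le x y s)

lemma run_emod_two (w : List ℤ) (x : ℕ) : (run x w : ℤ) % 2 = (x - w.sum) % 2 := by
  induction w generalizing x with
  | nil => simp
  | cons s w ih =>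
    rw [run_cons, ih, List.sum_cons]
    unfold reflect
    omega

/-- Steps from `D` can move the pair `|p|, |p + d|` to `|q|, |q + d|`, or bring the two points
closer to each other than `d`. -/
def Moves (D : Set ℤ) (d p q : ℤ) : Prop :=
  ∃ w : List ℤ, (∀ s ∈ w, s ∈ D) ∧
    ((run p.natAbs w = q.natAbs ∧ run (p + d).natAbs w = (q + d).natAbs) ∨
      |(run p.natAbs w : ℤ) - run (p + d).natAbs w| < d)

namespace Moves

variable {D : Set ℤ} {d p q r s y : ℤ}

lemma refl (D : Set ℤ) (d p : ℤ) : Moves D d p p := ⟨[], by simp⟩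

lemma trans (h₁ : Moves D d p q) (h₂ : Moves D d q r) : Moves D d p r := by
  obtain ⟨v, hv, h₁⟩ := h₁
  obtain ⟨w, hw, h₂⟩ := h₂
  refine ⟨v ++ w, by simpa [or_imp, forall_and] using ⟨hv, hw⟩, ?_⟩
  simp only [run_append]
  rcases h₁ with ⟨h, h'⟩ | h
  · rwa [h, h']
  · exact .inr ((abs_run_sub_le w _ _).trans_lt h)

/-- Here `p` and `p + d` have opposite signs, so taking absolute values has already shrunk the gap;
the target `q` is then irrelevant. -/
lemma of_between (h₁ : -d < p) (h₂ : p < 0) : Moves D d p q :=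
  ⟨[], by simp, .inr (by simp only [run_nil]; grind)⟩

lemma sub (hd : 0 ≤ d) (hp : 0 ≤ p) (hs : s ∈ D) : Moves D d p (p - s) :=
  ⟨[s], by simpa, .inl (by simp only [run_cons, run_nil, reflect]; omega)⟩

lemma add (hd : 0 ≤ d) (hp : p ≤ -d) (hs : s ∈ D) : Moves D d p (p + s) :=
  ⟨[s], by simpa, .inl (by simp only [run_cons, run_nil, reflect]; omega)⟩

/-- The step `y` decreases a nonnegative `p` and increases a `p ≤ -d`; in the window between, the
gap has shrunk and nothing remains to be done. -/
lemma emod (hd : 0 ≤ d) (hy : 0 < y) (hyD : y ∈ D) (p : ℤ) : Moves D d p (p % y) := by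
  have up : ∀ n : ℕ, ∀ r, 0 ≤ r → Moves D d (r + n * y) r := by
    intro n r hr
    induction n with
    | zero => simpa using refl D d r
    | succ n ih =>
      refine trans ?_ ih
      have := sub (D := D) (p := r + (n + 1 : ℕ) * y) hd (by positivity) hyD
      convert this using 1
      push_cast; ring
  have down : ∀ n : ℕ, ∀ r, 0 ≤ r → r < y → Moves D d (r - n * y) r := by
    intro n r hr hry
    induction n with
    | zero => simpa using refl D d r
    | succ n ih =>
      have hneg : r - (n + 1 : ℕ) * y < 0 := by push_cast; nlinarith
      rcases lt_or_ge (-d) (r - (n + 1 : ℕ) * y) with h | h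
      · exact of_between h hneg
      · refine trans ?_ ih
        convert add (D := D) hd h hyD using 1
        push_cast; ring
  have h0 := Int.emod_nonneg p hy.ne'
  have h1 := Int.emod_lt_of_pos p hy
  have h2 := Int.emod_add_mul_ediv p y
  rcases le_or_gt 0 (p / y) with h | h
  · have := up (p / y).toNat _ h0
    rwa [Int.toNat_of_nonneg h, mul_comm, h2] at this
  · have := down (-(p / y)).toNat _ h0 h1
    rwa [Int.toNat_of_nonneg (by omega), neg_mul, sub_neg_eq_add, mul_comm, h2] at this

/-- The accessible shifts `g` modulo `y` form a subgroup of `ℤ` containing `D`. It is cyclic, its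
generator divides all of `D`, so it is `ℤ`. -/
lemma sub_emod (hd : 0 ≤ d) (hy : 0 < y) (hyD : y ∈ D)
    (hD : ∀ a : ℕ, (∀ k ∈ D, (a : ℤ) ∣ k) → a = 1) (g : ℤ) :
    ∀ p, Moves D d p ((p - g) % y) := by
  let H' : AddSubmonoid ℤ :=
    { carrier := {g | ∀ p, Moves D d p ((p - g) % y)}
      zero_mem' := fun p => by simpa using emod hd hy hyD p
      add_mem' := by
        intro a b ha hb p
        have := (ha p).trans (hb _)
        rwa [Int.emod_sub_emod, sub_sub] at this }
  let H : AddSubgroup ℤ :=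
    { H' with
      neg_mem' := by
        intro a ha p
        -- Modulo `y`, the multiple `(y - 1) a` is `-a`, so closure under sums already yields
        -- inverses.
        have h1 : (y - 1).toNat • a ∈ H' := H'.nsmul_mem ha _
        have h2 := h1 p
        have h3 : (p - (y - 1).toNat • a) % y = (p - -a) % y := by
          rw [nsmul_eq_mul, Int.natCast_toNat_eq_self.2 (by omega)]
          rw [show p - (y - 1) * a = p - -a - y * a by ring, Int.sub_mul_emod_self_left]
        rwa [h3] at h2 }
  obtain ⟨a, ha⟩ := Int.subgroup_cyclic H
  have hDH : D ⊆ H := by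
    intro s hs p
    refine (emod hd hy hyD p).trans ((sub hd (Int.emod_nonneg _ hy.ne') hs).trans ?_)
    have := emod hd hy hyD (p % y - s)
    rwa [Int.emod_sub_emod] at this
  have ha1 : a.natAbs = 1 := hD _ fun k hk => by
    have : k ∈ H := hDH hk
    rw [ha] at this
    rw [Int.natCast_natAbs, abs_dvd]
    exact (Int.mem_zmultiples_iff).1 (by rwa [AddSubgroup.zmultiples_eq_closure])
  have : g ∈ H := by
    rw [ha, ← AddSubgroup.zmultiples_eq_closure, Int.mem_zmultiples_iff]
    exact Int.natAbs_dvd.1 (by rw [ha1]; simp)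
  exact this

lemma of_lt (hd : 0 ≤ d) (hy : 0 < y) (hyD : y ∈ D)
    (hD : ∀ a : ℕ, (∀ k ∈ D, (a : ℤ) ∣ k) → a = 1) (h0 : 0 ≤ q) (hq : q < y) :
    Moves D d p q := by
  have := sub_emod hd hy hyD hD (p - q) p
  rwa [sub_sub_cancel, Int.emod_eq_of_lt h0 hq] at this

end Moves

variable {D : Set ℤ}

lemma exists_run_abs_sub_lt {y : ℤ} (hy : 0 < y) (hyD : y ∈ D)
    (hD : ∀ a : ℕ, (∀ k ∈ D, (a : ℤ) ∣ k) → a = 1) {u v : ℕ} (huv : u ≠ v)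
    (hev : u % 2 = v % 2) :
    ∃ w : List ℤ, (∀ s ∈ w, s ∈ D) ∧ |(run u w : ℤ) - run v w| < |(u : ℤ) - v| := by
  wlog h : u < v generalizing u v
  · obtain ⟨w, hw, h'⟩ := this huv.symm hev.symm (by omega)
    exact ⟨w, hw, by rwa [abs_sub_comm, abs_sub_comm (u : ℤ)]⟩
  obtain ⟨d, hd⟩ : ∃ d : ℤ, d = v - u := ⟨_, rfl⟩
  -- The target `y - 1` is chosen so that the step `y` then gives `-1`, hence the pair `1`, `d - 1`
  -- with gap `d - 2`; equal parity ensures `d ≥ 2`.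
  have h1 : Moves D d u (y - 1) := .of_lt (by omega) hy hyD hD (by omega) (by omega)
  have h2 : Moves D d (y - 1) (y - 1 - y) := .sub (by omega) (by omega) hyD
  obtain ⟨w, hw, h3⟩ := h1.trans h2
  refine ⟨w, hw, ?_⟩
  rw [show ((u : ℤ) + d).natAbs = v by omega, Int.natAbs_natCast] at h3
  rcases h3 with ⟨h3, h3'⟩ | h3 <;> grind

lemma exists_run_eq {y : ℤ} (hyD : y ∈ D)
    (hD : ∀ a : ℕ, (∀ k ∈ D, (a : ℤ) ∣ k) → a = 1) (a : ℕ) {z : ℕ} (hz : z ≤ y) (hy : 0 < y) :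
    ∃ w : List ℤ, (∀ s ∈ w, s ∈ D) ∧ run a w = z := by
  have key : ∀ q : ℤ, 0 ≤ q → q < y → Moves D 0 a q := fun q h0 h1 =>
    .of_lt le_rfl hy hyD hD h0 h1
  -- Residues only cover `z < y`; the endpoint `z = y` is reached as `|-y|` by the step `y` from
  -- `0`. For `d = 0` the gap alternative in `Moves` is void.
  have : Moves D 0 a z ∨ Moves D 0 a (-z) := by
    rcases hz.lt_or_eq with h | h
    · exact .inl (key _ (by omega) h)
    · right
      simpa [h] using (key 0 le_rfl hy).trans (.sub le_rfl le_rfl hyD)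
  rcases this with ⟨w, hw, h⟩ | ⟨w, hw, h⟩
  · exact ⟨w, hw, by simpa using h⟩
  · exact ⟨w, hw, by simpa using h⟩

lemma exists_run_eq_of_neg {y t : ℤ} (hy : 0 < y) (hyD : y ∈ D) (ht : t < 0) (htD : t ∈ D)
    (hD : ∀ a : ℕ, (∀ k ∈ D, (a : ℤ) ∣ k) → a = 1) (a z : ℕ) :
    ∃ w : List ℤ, (∀ s ∈ w, s ∈ D) ∧ run a w = z := by
  have up : ∀ n : ℕ, ∀ r, 0 ≤ r → Moves D 0 r (r - n * t) := by
    intro n r hr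
    induction n with
    | zero => simpa using Moves.refl D 0 r
    | succ n ih =>
      refine ih.trans ?_
      convert Moves.sub (D := D) le_rfl (p := r - n * t) (by nlinarith) htD using 1
      push_cast; ring
  have down : ∀ n : ℕ, ∀ r, 0 ≤ r → Moves D 0 (r + n * y) r := by
    intro n r hr
    induction n with
    | zero => simpa using Moves.refl D 0 r
    | succ n ih =>
      refine Moves.trans ?_ ih
      convert Moves.sub (D := D) le_rfl (p := r + (n + 1 : ℕ) * y) (by positivity) hyD using 1
      push_cast; ring
  -- Start from the residue of `z + z * t`: after `z` steps `t` the position is congruent to `z`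
  -- modulo `y`, and at least `z` because `z + z * t ≤ 0`. Steps `y` then descend to `z`.
  have h0 := Int.emod_nonneg (z + z * t) hy.ne'
  have h1 := Int.emod_lt_of_pos (z + z * t) hy
  have h2 := Int.emod_add_mul_ediv (z + z * t) y
  have hle : (z + z * t) / y ≤ 0 := by
    have : (z : ℤ) + z * t ≤ 0 := by nlinarith [Int.natCast_nonneg z]
    exact Int.ediv_nonpos_of_nonpos_of_neg this hy
  have h3 := up z _ h0
  have h4 := down (-((z + z * t) / y)).toNat z (by omega)
  rw [Int.toNat_of_nonneg (by omega)] at h4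
  have h5 : (z + z * t) % y - z * t = z + -((z + z * t) / y) * y := by linarith
  rw [h5] at h3
  obtain ⟨w, hw, h⟩ := ((Moves.of_lt le_rfl hy hyD hD h0 h1 : Moves D 0 a _).trans h3).trans h4
  exact ⟨w, hw, by simpa using h⟩

end ReflectedWalk

/-! ### Trajectories as functions of the steps, and a conditional Borel–Cantelli lemma -/

namespace ReflectedWalk

/-- The trajectory of reflected random walk from `x` driven by the sequence of steps `s`. -/
def path (x : ℕ) (s : ℕ → ℤ) : ℕ → ℕ
  | 0 => x
  | n + 1 => reflect (path x s n) (s n)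

lemma path_succ' (x : ℕ) (s : ℕ → ℤ) (n : ℕ) :
    path x s (n + 1) = path (reflect x (s 0)) (fun j => s (j + 1)) n := by
  induction n with
  | zero => rfl
  | succ n ih => rw [path, ih, path]

lemma path_length_eq_run (w : List ℤ) (x : ℕ) (s : ℕ → ℤ)
    (h : ∀ j < w.length, s j = w.getD j 0) : path x s w.length = run x w := by
  induction w generalizing x s with
  | nil => rfl
  | cons a w ih =>
    rw [List.length_cons, path_succ', run_cons]
    have h0 : s 0 = a := by simpa using h 0 (by simp)
    rw [h0]
    exact ih _ _ fun j hj => by simpa using h (j + 1) (by simpa using hj)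

lemma measurable_path (x n : ℕ) : Measurable (fun s => path x s n) := by
  induction n with
  | zero => exact measurable_const
  | succ n ih =>
    have : Measurable (fun q : ℕ × ℤ => reflect q.1 q.2) := measurable_of_countable _
    exact this.comp (ih.prodMk (measurable_pi_apply n))

lemma natCast_path_emod_two (x : ℕ) (s : ℕ → ℤ) (n : ℕ) :
    (path x s n : ℤ) % 2 = (x - ∑ j ∈ Finset.range n, s j) % 2 := by
  induction n with
  | zero => simp [path]
  | succ n ih =>
    rw [Finset.sum_range_succ, path]
    unfold reflect
    omega

variable {Ω : Type*} {Y : ℕ → Ω → ℤ}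

lemma walk_eq_path (x n : ℕ) (ω : Ω) : walk Y x n ω = path x (fun j => Y (j + 1) ω) n := by
  induction n with
  | zero => rfl
  | succ n ih => rw [walk, path, ih]; rfl

lemma walk_add (x n m : ℕ) (ω : Ω) :
    walk Y x (n + m) ω = path (walk Y x n ω) (fun j => Y (n + 1 + j) ω) m := by
  induction m with
  | zero => rfl
  | succ m ih =>
    rw [← add_assoc, walk, ih, path, show n + m + 1 = n + 1 + m by ring]; rfl

lemma natCast_walk_emod_two (x n : ℕ) (ω : Ω) :
    (walk Y x n ω : ℤ) % 2 = (x - partialSum Y n ω) % 2 := by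
  rw [walk_eq_path, natCast_path_emod_two, partialSum, Finset.range_eq_Ico,
    Finset.sum_Ico_add' (fun j => Y j ω) 0 n 1]
  rfl

lemma even_partialSum_iff (x n : ℕ) (ω : Ω) :
    Even (partialSum Y n ω) ↔ walk Y x n ω % 2 = x % 2 := by
  have := natCast_walk_emod_two (Y := Y) x n ω
  rw [Int.even_iff]
  omega

lemma abs_walk_sub_antitone (x y : ℕ) (ω : Ω) :
    Antitone fun n => |(walk Y x n ω : ℤ) - walk Y y n ω| :=
  antitone_nat_of_succ_le fun _ => abs_reflect_sub_le _ _ _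

lemma measurable_shift {m : MeasurableSpace Ω} (h : ∀ k, Measurable[m] (Y k)) (n : ℕ) :
    Measurable[m] (fun ω j => Y (n + 1 + j) ω) :=
  measurable_pi_lambda _ fun _ => h _

lemma measurable_walk {m : MeasurableSpace Ω} {n : ℕ} (h : ∀ k ≤ n, Measurable[m] (Y k)) (x : ℕ) :
    Measurable[m] (walk Y x n) := by
  induction n with
  | zero => exact measurable_const
  | succ n ih =>
    have : Measurable (fun q : ℕ × ℤ => reflect q.1 q.2) := measurable_of_countable _
    exact this.comp ((ih fun k hk => h k (by omega)).prodMk (h (n + 1) le_rfl))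

variable [MeasurableSpace Ω] {P : Measure Ω} {μ : Measure ℤ}

lemma map_shift (hmeas : ∀ n, Measurable (Y n)) (hindep : iIndepFun Y P)
    (hlaw : ∀ n, P.map (Y n) = μ) (n : ℕ) :
    P.map (fun ω j => Y (n + 1 + j) ω) = Measure.infinitePi fun _ : ℕ => μ := by
  have h : iIndepFun (fun j => Y (n + 1 + j)) P :=
    hindep.precomp (g := fun j => n + 1 + j) (add_right_injective _)
  rw [h.map_fun_eq_infinitePi_map fun j => hmeas _]
  simp [hlaw]

/-- The σ-algebra generated by the steps up to time `n`. -/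
noncomputable def stepFiltration (hmeas : ∀ n, Measurable (Y n)) :
    Filtration ℕ (inferInstance : MeasurableSpace Ω) :=
  Filtration.natural Y fun n => (hmeas n).stronglyMeasurable

lemma measurable_step (hmeas : ∀ n, Measurable (Y n)) {k n : ℕ} (h : k ≤ n) :
    Measurable[stepFiltration hmeas n] (Y k) := by
  rw [measurable_iff_comap_le]
  exact le_iSup₂ (f := fun j (_ : j ≤ n) => MeasurableSpace.comap (Y j) _) k h

lemma measurable_walk_filtration (hmeas : ∀ n, Measurable (Y n)) (x n : ℕ) :
    Measurable[stepFiltration hmeas n] (walk Y x n) :=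
  measurable_walk (fun _ hk => measurable_step hmeas hk) x

lemma indep_shift (hmeas : ∀ n, Measurable (Y n)) (hindep : iIndepFun Y P) (n : ℕ) :
    Indep (MeasurableSpace.comap (fun ω j => Y (n + 1 + j) ω) MeasurableSpace.pi)
      (stepFiltration hmeas n) P := by
  have h := indep_iSup_of_disjoint (fun i => (hmeas i).comap_le)
    ((iIndepFun_iff_iIndep (fun _ => inferInstance) Y P).1 hindep)
    (S := Ioi n) (T := Iic n) (Iic_disjoint_Ioi le_rfl).symm
  refine indep_of_indep_of_le_left h ?_
  rw [MeasurableSpace.pi, MeasurableSpace.comap_iSup]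
  refine iSup_le fun j => ?_
  rw [MeasurableSpace.comap_comp]
  exact le_iSup₂ (f := fun i (_ : i ∈ Ioi n) => MeasurableSpace.comap (Y i) _) (n + 1 + j)
    (by simp; omega)

/-- If events `A n` that depend on the steps up to time `n` occur infinitely often, then almost
surely infinitely many of them are followed by a sequence of steps in a given set of positive
probability. -/
theorem frequently_and_shift_mem [IsProbabilityMeasure P] [IsProbabilityMeasure μ]
    (hmeas : ∀ n, Measurable (Y n)) (hindep : iIndepFun Y P)
    (hlaw : ∀ n, P.map (Y n) = μ) {A : ℕ → Set Ω}
    (hA : ∀ n, MeasurableSet[stepFiltration hmeas n] (A n)) {B : Set (ℕ → ℤ)}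
    (hB : MeasurableSet B) (hpos : Measure.infinitePi (fun _ : ℕ => μ) B ≠ 0) :
    ∀ᵐ ω ∂P, (∃ᶠ n in atTop, ω ∈ A n) →
      ∃ᶠ n in atTop, ω ∈ A n ∧ (fun j => Y (n + 1 + j) ω) ∈ B := by
  set F := stepFiltration hmeas
  let B' : ℕ → Set Ω := fun n => (fun ω j => Y (n + 1 + j) ω) ⁻¹' B
  have hsh : ∀ n, Measurable (fun ω j => Y (n + 1 + j) ω) :=
    measurable_shift hmeas
  have hB' : ∀ n, MeasurableSet (B' n) := fun n => hsh n hB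
  have hPB : ∀ n, P.real (B' n) = (Measure.infinitePi (fun _ : ℕ => μ)).real B := fun n => by
    rw [← map_shift hmeas hindep hlaw n, map_measureReal_apply (hsh n) hB]
  set c := (Measure.infinitePi (fun _ : ℕ => μ)).real B with hc
  have hc0 : 0 < c := by
    rw [hc, Measure.real, ENNReal.toReal_pos_iff]
    exact ⟨pos_iff_ne_zero.2 hpos, measure_lt_top _ _⟩
  have hYF : ∀ n, Measurable[⨆ n, F n] (Y n) := fun n =>
    (measurable_step hmeas le_rfl).mono (le_iSup (fun n => F n) n) le_rfl
  let E : ℕ → Set Ω := fun m => ⋃ n ≥ m, A n ∩ B' n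
  have hE : ∀ m, MeasurableSet[⨆ n, F n] (E m) := fun m => by
    refine MeasurableSet.iUnion fun n => MeasurableSet.iUnion fun _ => ?_
    refine MeasurableSet.inter (le_iSup (fun n => F n) n _ (hA n)) ?_
    exact measurable_shift hYF n hB
  have hle : ⨆ n, F n ≤ (inferInstance : MeasurableSpace Ω) := iSup_le fun n => F.le n
  have hint : ∀ s, MeasurableSet s → Integrable (s.indicator fun _ => (1 : ℝ)) P :=
    fun s hs => (integrable_const 1).indicator hs
  -- On `A k`, the future after time `k` is independent of `F k` and lies in `B` with probability
  -- `c`, which bounds the conditional probability of `E m` from below.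
  have hlow : ∀ m k, m ≤ k → ∀ᵐ ω ∂P, ω ∈ A k →
      c ≤ (P[(E m).indicator (fun _ => (1 : ℝ)) | F k]) ω := by
    intro m k hmk
    have h1 : P[(A k).indicator ((B' k).indicator fun _ => (1 : ℝ)) | F k] ≤ᵐ[P]
        P[(E m).indicator (fun _ => (1 : ℝ)) | F k] := by
      refine condExp_mono ((hint _ (hB' k)).indicator (F.le k _ (hA k)))
        (hint _ (hle _ (hE m))) (.of_forall ?_)
      rw [indicator_indicator]
      refine indicator_le_indicator_of_subset ?_ (fun _ => zero_le_one)
      exact subset_iUnion₂ (s := fun n (_ : n ≥ m) => A n ∩ B' n) k hmk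
    have h2 := condExp_indicator (m := F k) (hint _ (hB' k)) (hA k)
    have h3 : P[(B' k).indicator (fun _ => (1 : ℝ)) | F k] =ᵐ[P]
        fun _ => P[(B' k).indicator fun _ => (1 : ℝ)] :=
      condExp_indep_eq ((hsh k).comap_le) (F.le k)
        (stronglyMeasurable_const.indicator ⟨B, hB, rfl⟩) (indep_shift hmeas hindep k)
    filter_upwards [h1, h2, h3] with ω h1 h2 h3 hω
    rw [h2, indicator_of_mem hω, h3, integral_indicator_const _ (hB' k), hPB] at h1
    simpa using h1
  have hlim : ∀ m, ∀ᵐ ω ∂P, Tendsto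
      (fun n => (P[(E m).indicator (fun _ => (1 : ℝ)) | F n]) ω) atTop
      (𝓝 ((E m).indicator (fun _ => (1 : ℝ)) ω)) := fun m =>
    (hint _ (hle _ (hE m))).tendsto_ae_condExp (stronglyMeasurable_const.indicator (hE m))
  have hlow' := fun m => ae_all_iff.2 fun k => ae_all_iff.2 fun h => hlow m k h
  filter_upwards [ae_all_iff.2 hlim, ae_all_iff.2 hlow'] with ω h1 h2 h3
  rw [frequently_atTop]
  intro m
  -- The conditional probabilities converge to the indicator of `E m` and are at least `c > 0`
  -- infinitely often, so the indicator cannot vanish.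
  have h4 : c ≤ (E m).indicator (fun _ => (1 : ℝ)) ω := by
    refine ge_of_tendsto_of_frequently (h1 m) ?_
    exact (h3.and_eventually (eventually_ge_atTop m)).mono fun k hk => h2 m k hk.2 hk.1
  have h5 : ω ∈ E m := by
    by_contra h
    rw [indicator_of_notMem h] at h4
    linarith
  simpa [E, B', and_left_comm] using h5

/-- The sequences that begin with the word `w`. -/
def cylinderOf (w : List ℤ) : Set (ℕ → ℤ) := {s | ∀ j < w.length, s j = w.getD j 0}

lemma cylinderOf_eq_pi (w : List ℤ) :
    cylinderOf w = Set.pi (Finset.range w.length) fun j => {w.getD j 0} := by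
  ext s; simp [cylinderOf]

lemma measurableSet_cylinderOf (w : List ℤ) : MeasurableSet (cylinderOf w) := by
  rw [cylinderOf_eq_pi]
  exact MeasurableSet.pi (Finset.countable_toSet _) fun _ _ => measurableSet_singleton _

lemma mem_support_iff_singleton {k : ℤ} : k ∈ μ.support ↔ μ {k} ≠ 0 := by
  rw [Measure.mem_support_iff_forall]
  simp only [nhds_discrete, mem_pure]
  exact ⟨fun h => (h {k} rfl).ne', fun h U hU =>
    (pos_iff_ne_zero.2 h).trans_le (measure_mono (singleton_subset_iff.2 hU))⟩

lemma infinitePi_cylinderOf_ne_zero [IsProbabilityMeasure μ] {w : List ℤ} (hw : ∀ s ∈ w, s ∈ μ.support) :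
    Measure.infinitePi (fun _ : ℕ => μ) (cylinderOf w) ≠ 0 := by
  rw [cylinderOf_eq_pi, Measure.infinitePi_pi _ fun _ _ => measurableSet_singleton _,
    Finset.prod_ne_zero_iff]
  intro j hj
  rw [Finset.mem_range] at hj
  rw [List.getD_eq_getElem _ _ hj]
  exact mem_support_iff_singleton.1 (hw _ (List.getElem_mem hj))

lemma ae_step_mem_support (hmeas : ∀ n, Measurable (Y n)) (hlaw : ∀ n, P.map (Y n) = μ) :
    ∀ᵐ ω ∂P, ∀ n, Y n ω ∈ μ.support := by
  refine ae_all_iff.2 fun n => ?_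
  have : ∀ᵐ k ∂(P.map (Y n)), k ∈ μ.support := by
    rw [hlaw]; exact Measure.support_mem_ae
  exact ae_of_ae_map (hmeas n).aemeasurable this

end ReflectedWalk

/-! ### Essential class, coalescence and recurrence of the walk -/

namespace ReflectedWalk

/-- The steps `Y n` are independent random variables with law `μ`. -/
structure IsStepSequence {Ω : Type*} [MeasurableSpace Ω] (P : Measure Ω) (μ : Measure ℤ)
    (Y : ℕ → Ω → ℤ) : Prop where
  measurable : ∀ n, Measurable (Y n)
  indep : iIndepFun Y P
  law : ∀ n, P.map (Y n) = μ

/-- The law `μ` of the steps charges the positive integers, and its support has greatest common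
divisor `1`. -/
structure IsAdmissible (μ : Measure ℤ) : Prop where
  pos : 0 < μ (Set.Ioi 0)
  gcd : ∀ d : ℕ, (∀ k ∈ μ.support, (d : ℤ) ∣ k) → d = 1

section EssentialClass

variable {μ : Measure ℤ}

lemma IsAdmissible.exists_pos (h : IsAdmissible μ) : ∃ y ∈ μ.support, 0 < y := by
  obtain ⟨y, hy, hy'⟩ := Measure.nonempty_inter_support_of_pos h.pos
  exact ⟨y, hy', hy⟩

lemma IsAdmissible.exists_odd (h : IsAdmissible μ) : ∃ y ∈ μ.support, Odd y := by
  by_contra! hc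
  have := h.gcd 2 fun k hk => (Int.not_odd_iff_even.1 (hc k hk)).two_dvd
  omega

lemma mem_essentialClass_of_le {x : ℕ} {y : ℤ} (hy : y ∈ μ.support) (hx : x ≤ y) :
    x ∈ essentialClass μ := by
  unfold essentialClass supSupport
  rw [mem_ofPred_eq]
  split_ifs
  · exact le_iSup₂_of_le y hy (by exact_mod_cast (by omega : x ≤ y.toNat))
  · exact le_top

lemma mem_essentialClass_mono {x y : ℕ} (hy : y ∈ essentialClass μ) (hx : x ≤ y) :
    x ∈ essentialClass μ := by
  simp only [essentialClass, mem_ofPred_eq] at hy ⊢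
  exact (Nat.cast_le.2 hx).trans hy

lemma zero_mem_essentialClass : 0 ∈ essentialClass μ := by simp [essentialClass]

lemma IsAdmissible.one_mem_essentialClass (h : IsAdmissible μ) : 1 ∈ essentialClass μ := by
  obtain ⟨y, hy, hy0⟩ := h.exists_pos
  exact mem_essentialClass_of_le hy (by omega)

/-- For nonnegative steps the new position is at most the larger of `x` and `s`; with a negative
step in the support the class is everything. -/
lemma reflect_mem_essentialClass {x : ℕ} {s : ℤ} (hx : x ∈ essentialClass μ)
    (hs : s ∈ μ.support) : reflect x s ∈ essentialClass μ := by
  by_cases h : ∀ k ∈ μ.support, 0 ≤ k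
  · have h0 := h s hs
    rcases le_total s x with h1 | h1
    · exact mem_essentialClass_mono hx (by unfold reflect; omega)
    · exact mem_essentialClass_of_le hs (by unfold reflect; omega)
  · simp [essentialClass, supSupport, h]

lemma IsAdmissible.exists_run_eq (h : IsAdmissible μ) (a : ℕ) {z : ℕ}
    (hz : z ∈ essentialClass μ) : ∃ w : List ℤ, (∀ s ∈ w, s ∈ μ.support) ∧ run a w = z := by
  obtain ⟨y, hy, hy0⟩ := h.exists_pos
  by_cases hnn : ∀ k ∈ μ.support, 0 ≤ k
  · have : ∃ k ∈ μ.support, 0 < k ∧ z ≤ k := by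
      by_contra! hc
      have hz0 : 1 ≤ z := by have := hc y hy hy0; omega
      have h1 : supSupport μ ≤ ((z - 1 : ℕ) : ℕ∞) := by
        rw [supSupport, if_pos hnn]
        refine iSup₂_le fun k hk => ?_
        have h2 := hnn k hk
        have h3 := hc k hk
        exact_mod_cast (by omega : k.toNat ≤ z - 1)
      have h2 : (z : ℕ∞) ≤ ((z - 1 : ℕ) : ℕ∞) := le_trans hz h1
      have h3 : z ≤ z - 1 := by exact_mod_cast h2
      omega
    obtain ⟨k, hk, hk0, hzk⟩ := this
    exact ReflectedWalk.exists_run_eq hk h.gcd a hzk hk0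
  · push Not at hnn
    obtain ⟨t, ht, ht0⟩ := hnn
    exact exists_run_eq_of_neg hy0 hy ht0 ht h.gcd a z

end EssentialClass

section Walk

variable {Ω : Type*} {Y : ℕ → Ω → ℤ}

lemma walk_eq_of_le {x y n m : ℕ} {ω : Ω} (h : walk Y x n ω = walk Y y n ω) (hnm : n ≤ m) :
    walk Y x m ω = walk Y y m ω := by
  have := abs_walk_sub_antitone (Y := Y) x y ω hnm
  simp only [h, sub_self, abs_zero, abs_nonpos_iff] at this
  omega

variable [MeasurableSpace Ω] {P : Measure Ω} {μ : Measure ℤ}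

lemma IsStepSequence.ae_mem_essentialClass (hY : IsStepSequence P μ Y) :
    ∀ᵐ ω ∂P, ∀ x n m, walk Y x n ω ∈ essentialClass μ → n ≤ m →
      walk Y x m ω ∈ essentialClass μ := by
  filter_upwards [ae_step_mem_support hY.measurable hY.law] with ω hω x n m hn hnm
  induction m, hnm using Nat.le_induction with
  | base => exact hn
  | succ m _ ih => exact reflect_mem_essentialClass ih (hω (m + 1))

/-- A trajectory that almost surely returns to its starting point does so infinitely often. -/
theorem IsStepSequence.ae_frequently_of_ae_exists (hY : IsStepSequence P μ Y) {z : ℕ}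
    (h : ∀ᵐ ω ∂P, ∃ n, 1 ≤ n ∧ walk Y z n ω = z) :
    ∀ᵐ ω ∂P, ∃ᶠ n in atTop, walk Y z n ω = z := by
  have hB : MeasurableSet {s : ℕ → ℤ | ∃ n, 1 ≤ n ∧ path z s n = z} := by
    have : {s : ℕ → ℤ | ∃ n, 1 ≤ n ∧ path z s n = z} =
        ⋃ n ≥ 1, (fun s => path z s n) ⁻¹' {z} := by
      ext s; simp
    rw [this]
    exact .iUnion fun n => .iUnion fun _ => measurable_path z n (measurableSet_singleton z)
  have hmap : ∀ n, P ((fun ω j => Y (n + 1 + j) ω) ⁻¹'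
      {s : ℕ → ℤ | ∃ n, 1 ≤ n ∧ path z s n = z}ᶜ) = 0 := fun n => by
    rw [← Measure.map_apply (measurable_shift hY.measurable n) hB.compl,
      map_shift hY.measurable hY.indep hY.law, ← map_shift hY.measurable hY.indep hY.law 0,
      Measure.map_apply (measurable_shift hY.measurable 0) hB.compl]
    refine measure_mono_null ?_ (ae_iff.1 h)
    intro ω hω
    simpa [walk_eq_path, add_comm] using hω
  filter_upwards [ae_all_iff.2 fun n => compl_mem_ae_iff.2 (hmap n)] with ω hω
  rw [frequently_atTop]
  intro m
  induction m with
  | zero => exact ⟨0, le_rfl, rfl⟩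
  | succ m ih =>
    obtain ⟨l, hl, hlz⟩ := ih
    obtain ⟨n, hn, h'⟩ := not_not.1 (hω l)
    exact ⟨l + n, by omega, by rw [walk_add, hlz, h']⟩

variable [IsProbabilityMeasure P] [IsProbabilityMeasure μ]

/-- If a pair of trajectories visits `(u, v)` infinitely often, then it also follows infinitely
often any word `w` in the support of `μ` from there. -/
lemma IsStepSequence.ae_frequently_run (hY : IsStepSequence P μ Y) (x y u v : ℕ) {w : List ℤ}
    (hw : ∀ s ∈ w, s ∈ μ.support) :
    ∀ᵐ ω ∂P, (∃ᶠ n in atTop, walk Y x n ω = u ∧ walk Y y n ω = v) →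
      ∃ᶠ n in atTop, walk Y x n ω = run u w ∧ walk Y y n ω = run v w := by
  have hA : ∀ n, MeasurableSet[stepFiltration hY.measurable n]
      {ω | walk Y x n ω = u ∧ walk Y y n ω = v} := fun n =>
    (measurable_walk_filtration hY.measurable x n (measurableSet_singleton u)).inter
      (measurable_walk_filtration hY.measurable y n (measurableSet_singleton v))
  filter_upwards [frequently_and_shift_mem hY.measurable hY.indep hY.law hA
    (measurableSet_cylinderOf w) (infinitePi_cylinderOf_ne_zero hw)] with ω hω hfreq
  refine (tendsto_add_atTop_nat w.length).frequently ((hω hfreq).mono ?_)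
  rintro n ⟨⟨h1, h2⟩, h3⟩
  rw [walk_add, walk_add, h1, h2]
  exact ⟨path_length_eq_run _ _ _ h3, path_length_eq_run _ _ _ h3⟩

/-- Two trajectories whose starting points have the same parity coalesce if one of them visits
some point infinitely often. -/
theorem IsStepSequence.ae_coalesce (hY : IsStepSequence P μ Y) (hμ : IsAdmissible μ) (x y z : ℕ)
    (hxy : x % 2 = y % 2) :
    ∀ᵐ ω ∂P, (∃ᶠ n in atTop, walk Y x n ω = z) →
      ∀ᶠ n in atTop, walk Y x n ω = walk Y y n ω := by
  obtain ⟨k, hk, hk0⟩ := hμ.exists_pos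
  have hw : ∀ v, ∃ w : List ℤ, (∀ s ∈ w, s ∈ μ.support) ∧
      (z ≠ v → z % 2 = v % 2 → |(run z w : ℤ) - run v w| < |(z : ℤ) - v|) := fun v => by
    by_cases h : z ≠ v ∧ z % 2 = v % 2
    · obtain ⟨w, hw, h'⟩ := exists_run_abs_sub_lt hk0 hk hμ.gcd h.1 h.2
      exact ⟨w, hw, fun _ _ => h'⟩
    · exact ⟨[], by simp, fun h1 h2 => absurd ⟨h1, h2⟩ h⟩
  choose w hw hlt using hw
  filter_upwards [ae_all_iff.2 fun v => hY.ae_frequently_run x y z v (hw v)] with ω hω hz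
  have hanti := abs_walk_sub_antitone (Y := Y) x y ω
  -- Whenever the first trajectory is in `z`, the second is at most `x + y + z`, as the gap never
  -- exceeds `|x - y|`. Pigeonhole gives a recurring `v`.
  obtain ⟨v, hv⟩ : ∃ v, ∃ᶠ n in atTop, walk Y x n ω = z ∧ walk Y y n ω = v := by
    by_contra! hc
    have hfin := (eventually_all_finite (finite_Iic (x + y + z))).2 fun v _ => hc v
    obtain ⟨n, hn1, hn2⟩ := (hz.and_eventually hfin).exists
    refine hn2 (walk Y y n ω) ?_ hn1 rfl
    have := hanti (Nat.zero_le n)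
    simp only [hn1, walk] at this
    have h1 := neg_le_of_abs_le this
    have h2 := neg_abs_le ((x : ℤ) - y)
    have h3 : |(x : ℤ) - y| ≤ x + y := abs_le.2 ⟨by omega, by omega⟩
    simp only [mem_Iic]
    omega
  have key : ∃ n, walk Y x n ω = walk Y y n ω := by
    by_cases hzv : z = v
    · obtain ⟨n, h1, h2⟩ := hv.exists
      exact ⟨n, by rw [h1, h2, hzv]⟩
    · exfalso
      obtain ⟨n, h1, h2⟩ := hv.exists
      have hpar : z % 2 = v % 2 := by
        have h3 := natCast_walk_emod_two (Y := Y) x n ω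
        have h4 := natCast_walk_emod_two (Y := Y) y n ω
        omega
      -- The gap drops below `|z - v|` at time `m`, yet equals `|z - v|` again at a later visit to
      -- `(z, v)`.
      obtain ⟨m, h3, h4⟩ := (hω v hv).exists
      obtain ⟨l, hl, h5, h6⟩ := frequently_atTop.1 hv m
      have := hanti hl
      simp only [h3, h4, h5, h6] at this
      exact absurd (hlt v hzv hpar) (not_lt.2 this)
  obtain ⟨n, hn⟩ := key
  exact eventually_atTop.2 ⟨n, fun m hm => walk_eq_of_le hn hm⟩

lemma measurableSet_frequently_path (x z : ℕ) :
    MeasurableSet {s : ℕ → ℤ | ∃ᶠ n in atTop, path x s n = z} := by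
  have : {s : ℕ → ℤ | ∃ᶠ n in atTop, path x s n = z} =
      ⋂ m, ⋃ n ≥ m, (fun s => path x s n) ⁻¹' {z} := by
    ext s; simp [frequently_atTop]
  rw [this]
  exact .iInter fun m => .iUnion fun n => .iUnion fun _ =>
    measurable_path x n (measurableSet_singleton z)

/-- A point that is visited infinitely often with positive probability from some starting point
is almost surely visited infinitely often by the trajectory that starts there. -/
theorem IsStepSequence.ae_frequently_self (hY : IsStepSequence P μ Y) {x z : ℕ}
    (h : ¬ ∀ᵐ ω ∂P, ¬ ∃ᶠ n in atTop, walk Y x n ω = z) :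
    ∀ᵐ ω ∂P, ∃ᶠ n in atTop, walk Y z n ω = z := by
  have hB := (measurableSet_frequently_path z z).compl
  have hzero : Measure.infinitePi (fun _ : ℕ => μ) {s | ∃ᶠ n in atTop, path z s n = z}ᶜ = 0 := by
    -- Otherwise, among infinitely many visits to `z`, one would be followed by steps that lead back
    -- to `z` only finitely often.
    by_contra hpos
    apply h
    have hA : ∀ n, MeasurableSet[stepFiltration hY.measurable n] {ω | walk Y x n ω = z} :=
      fun n => measurable_walk_filtration hY.measurable x n (measurableSet_singleton z)
    filter_upwards [frequently_and_shift_mem hY.measurable hY.indep hY.law hA hB hpos]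
      with ω hω hfreq
    obtain ⟨n, h1, h2⟩ := (hω hfreq).exists
    rw [mem_compl_iff, mem_ofPred_eq] at h2
    refine h2 (frequently_atTop.2 fun m => ?_)
    obtain ⟨l, hl, h3⟩ := frequently_atTop.1 hfreq (n + m)
    obtain ⟨k, rfl⟩ := Nat.exists_eq_add_of_le ((Nat.le_add_right n m).trans hl)
    rw [walk_add, h1] at h3
    exact ⟨k, by omega, h3⟩
  rw [← map_shift hY.measurable hY.indep hY.law 0,
    Measure.map_apply (measurable_shift hY.measurable 0) hB] at hzero
  filter_upwards [compl_mem_ae_iff.2 hzero] with ω hω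
  simpa [walk_eq_path, add_comm] using hω

end Walk

end ReflectedWalk

/-! ### Even times and return times -/

namespace ReflectedWalk

section ReturnTime

variable {𝕏 : Type*} {Z : ℕ → 𝕏} {x : 𝕏}

lemma returnTime_le {n : ℕ} (hn : 1 ≤ n) (h : Z n = x) : returnTime Z x ≤ n :=
  iInf₂_le n ⟨hn, h⟩

lemma lt_returnTime_iff {k : ℕ} :
    (k : ℕ∞) < returnTime Z x ↔ ∀ j, 1 ≤ j → Z j = x → k < j := by
  rw [← ENat.add_one_le_iff (ENat.natCast_ne_top k)]
  unfold returnTime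
  simp only [le_iInf_iff, mem_ofPred_eq, and_imp]
  refine forall₃_congr fun j _ _ => ?_
  rw [← Nat.add_one_le_iff]
  exact_mod_cast Iff.rfl

lemma exists_of_returnTime_lt_top (h : returnTime Z x < ⊤) :
    ∃ n, 1 ≤ n ∧ Z n = x ∧ returnTime Z x = n := by
  obtain ⟨n, hn⟩ := ENat.ne_top_iff_exists.1 h.ne
  have h1 : ¬ ((n : ℕ∞) < returnTime Z x) := by rw [hn]; exact lt_irrefl _
  rw [lt_returnTime_iff] at h1
  push Not at h1
  obtain ⟨j, hj, hjx, hjn⟩ := h1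
  have h2 : (n : ℕ∞) ≤ j := hn ▸ returnTime_le hj hjx
  have h3 : j = n := le_antisymm hjn (by exact_mod_cast h2)
  exact ⟨n, h3 ▸ hj, h3 ▸ hjx, hn.symm⟩

end ReturnTime

section EvenTime

variable {Ω : Type*} {Y : ℕ → Ω → ℤ} {ω : Ω}

lemma infinite_even (h : ∃ᶠ k in atTop, Even (partialSum Y k ω)) :
    {k | Even (partialSum Y k ω)}.Infinite :=
  Nat.frequently_atTop_iff_infinite.1 h

lemma even_partialSum_zero : Even (partialSum Y 0 ω) := by simp [partialSum]

lemma evenTime_eq_nth (h : ∃ᶠ k in atTop, Even (partialSum Y k ω)) (n : ℕ) :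
    evenTime Y n ω = Nat.nth (fun k => Even (partialSum Y k ω)) n := by
  have hinf := infinite_even h
  induction n with
  | zero => rw [evenTime, Nat.nth_zero_of_zero even_partialSum_zero]
  | succ n ih =>
    rw [evenTime, Nat.nth_eq_sInf, ih]
    congr 1
    ext k
    simp only [mem_ofPred_eq]
    rw [and_comm]
    refine and_congr_right fun _ => ⟨fun hk j hj => ?_, fun hk => hk n (Nat.lt_succ_self n)⟩
    exact ((Nat.nth_le_nth hinf).2 (Nat.lt_succ_iff.1 hj)).trans_lt hk

lemma strictMono_evenTime (h : ∃ᶠ k in atTop, Even (partialSum Y k ω)) :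
    StrictMono fun n => evenTime Y n ω := by
  simp only [evenTime_eq_nth h]
  exact Nat.nth_strictMono (infinite_even h)

lemma even_partialSum_evenTime (h : ∃ᶠ k in atTop, Even (partialSum Y k ω)) (n : ℕ) :
    Even (partialSum Y (evenTime Y n ω) ω) := by
  rw [evenTime_eq_nth h]
  exact Nat.nth_mem_of_infinite (infinite_even h) n

lemma exists_evenTime_eq (h : ∃ᶠ k in atTop, Even (partialSum Y k ω)) {k : ℕ}
    (hk : Even (partialSum Y k ω)) : ∃ n, evenTime Y n ω = k := by
  classical
  exact ⟨_, (evenTime_eq_nth h _).trans (Nat.nth_count hk)⟩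

lemma inducedWalk_mod_two (h : ∃ᶠ k in atTop, Even (partialSum Y k ω)) (x n : ℕ) :
    inducedWalk Y x n ω % 2 = x % 2 :=
  (even_partialSum_iff x _ ω).1 (even_partialSum_evenTime h n)

/-- A visit to a point with the parity of the start can only occur at an even time, so the induced
process misses none. -/
lemma frequently_inducedWalk_iff (h : ∃ᶠ k in atTop, Even (partialSum Y k ω)) {x z : ℕ}
    (hxz : z % 2 = x % 2) :
    (∃ᶠ n in atTop, inducedWalk Y x n ω = z) ↔ ∃ᶠ n in atTop, walk Y x n ω = z := by
  refine ⟨fun hf => (strictMono_evenTime h).tendsto_atTop.frequently hf, fun hf => ?_⟩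
  rw [frequently_atTop]
  intro m
  obtain ⟨k, hk, hkz⟩ := frequently_atTop.1 hf (evenTime Y m ω)
  obtain ⟨n, hn⟩ := exists_evenTime_eq h ((even_partialSum_iff x k ω).2 (by rw [hkz, hxz]))
  exact ⟨n, (strictMono_evenTime h).le_iff_le.1 (by simpa [hn] using hk),
    by rw [inducedWalk, hn, hkz]⟩

lemma returnTime_inducedWalk_le (h : ∃ᶠ k in atTop, Even (partialSum Y k ω)) (x : ℕ) :
    returnTime (fun n => inducedWalk Y x n ω) x ≤ returnTime (fun n => walk Y x n ω) x := by
  by_cases ht : returnTime (fun n => walk Y x n ω) x < ⊤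
  · obtain ⟨k, hk, hkx, heq⟩ := exists_of_returnTime_lt_top ht
    obtain ⟨n, hn⟩ := exists_evenTime_eq h ((even_partialSum_iff x k ω).2 (by rw [hkx]))
    have hn1 : 1 ≤ n := by
      rcases Nat.eq_zero_or_pos n with rfl | h0
      · rw [evenTime] at hn; omega
      · exact h0
    rw [heq]
    refine (returnTime_le hn1 (by rw [inducedWalk, hn, hkx])).trans ?_
    exact_mod_cast hn ▸ (strictMono_evenTime h).le_apply
  · rw [not_lt_top_iff.1 ht]; exact le_top

lemma returnTime_walk_le_evenTime (h : ∃ᶠ k in atTop, Even (partialSum Y k ω)) {x n : ℕ}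
    (hn : 1 ≤ n) (hx : inducedWalk Y x n ω = x) :
    returnTime (fun n => walk Y x n ω) x ≤ evenTime Y n ω :=
  returnTime_le (hn.trans (strictMono_evenTime h).le_apply) hx

open Classical in
/-- Before the first return of the walk, the steps that end at an even time are at most as many
as the steps of the induced walk before its first return. -/
lemma tsum_even_succ_le (h : ∃ᶠ k in atTop, Even (partialSum Y k ω)) (x : ℕ) :
    ∑' k : ℕ, (if (k : ℕ∞) < returnTime (fun n => walk Y x n ω) x ∧
      Even (partialSum Y (k + 1) ω) then (1 : ℝ≥0∞) else 0) ≤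
    (returnTime (fun n => inducedWalk Y x n ω) x : ℝ≥0∞) := by
  by_cases ht : returnTime (fun n => inducedWalk Y x n ω) x < ⊤
  swap
  · rw [not_lt_top_iff.1 ht]; simp
  obtain ⟨n, hn, hx, heq⟩ := exists_of_returnTime_lt_top ht
  have hle := returnTime_walk_le_evenTime h hn hx
  set p : ℕ → Prop := fun k => Even (partialSum Y k ω) with hp
  rw [evenTime_eq_nth h] at hle
  -- The shift by one drops `t(0) = 0` and includes `t(n)`, so the count is still `n`.
  have hc : (Nat.count (fun k => p (k + 1)) (Nat.nth p n)) = n := by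
    have h1 := Nat.count_succ' (p := p) (Nat.nth p n)
    rw [Nat.count_succ, Nat.count_nth_of_infinite (infinite_even h),
      if_pos (Nat.nth_mem_of_infinite (infinite_even h) n),
      if_pos (even_partialSum_zero : p 0)] at h1
    omega
  rw [heq, tsum_eq_sum (s := Finset.range (Nat.nth p n))]
  · calc _ ≤ ∑ k ∈ Finset.range (Nat.nth p n), (if p (k + 1) then (1 : ℝ≥0∞) else 0) := by
          refine Finset.sum_le_sum fun k _ => ?_
          split_ifs with h1 h2 <;> simp_all
      _ = n := by
          rw [← Finset.sum_filter, Finset.sum_const, ← Nat.count_eq_card_filter_range, hc]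
          simp
      _ = _ := by simp
  · intro k hk
    refine if_neg fun hk' => hk (Finset.mem_range.2 ?_)
    exact_mod_cast hk'.1.trans_le hle

-- The walk returns by time `t(n)`, where `n` is the return time of the induced process, and exactly
-- `n` even times precede `t(n)`.
open Classical in
lemma tsum_even_le (h : ∃ᶠ k in atTop, Even (partialSum Y k ω)) (x : ℕ) :
    ∑' k : ℕ, (if (k : ℕ∞) < returnTime (fun n => walk Y x n ω) x ∧
      Even (partialSum Y k ω) then (1 : ℝ≥0∞) else 0) ≤
    (returnTime (fun n => inducedWalk Y x n ω) x : ℝ≥0∞) := by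
  by_cases ht : returnTime (fun n => inducedWalk Y x n ω) x < ⊤
  swap
  · rw [not_lt_top_iff.1 ht]; simp
  obtain ⟨n, hn, hx, heq⟩ := exists_of_returnTime_lt_top ht
  have hle := returnTime_walk_le_evenTime h hn hx
  set p : ℕ → Prop := fun k => Even (partialSum Y k ω) with hp
  rw [evenTime_eq_nth h] at hle
  rw [heq, tsum_eq_sum (s := Finset.range (Nat.nth p n))]
  · calc _ ≤ ∑ k ∈ Finset.range (Nat.nth p n), (if p k then (1 : ℝ≥0∞) else 0) := by
          refine Finset.sum_le_sum fun k _ => ?_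
          split_ifs with h1 h2 <;> simp_all
      _ = n := by
          rw [← Finset.sum_filter, Finset.sum_const, ← Nat.count_eq_card_filter_range,
            Nat.count_nth_of_infinite (infinite_even h)]
          simp
      _ = _ := by simp
  · intro k hk
    refine if_neg fun hk' => hk (Finset.mem_range.2 ?_)
    exact_mod_cast hk'.1.trans_le hle

end EvenTime

section Walk

variable {Ω : Type*} [MeasurableSpace Ω] {P : Measure Ω} [IsProbabilityMeasure P]
  {μ : Measure ℤ} [IsProbabilityMeasure μ] {Y : ℕ → Ω → ℤ}

/-- Almost surely, the partial sums are even infinitely often. -/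
theorem IsStepSequence.ae_frequently_even (hY : IsStepSequence P μ Y) (hμ : IsAdmissible μ) :
    ∀ᵐ ω ∂P, ∃ᶠ k in atTop, Even (partialSum Y k ω) := by
  obtain ⟨y, hy, hodd⟩ := hμ.exists_odd
  have hA : ∀ n, MeasurableSet[stepFiltration hY.measurable n]
      {ω | walk Y 0 n ω % 2 = 1} := fun n =>
    measurable_walk_filtration hY.measurable 0 n (MeasurableSet.of_discrete (s := {k | k % 2 = 1}))
  filter_upwards [frequently_and_shift_mem hY.measurable hY.indep hY.law hA
    (measurableSet_cylinderOf [y]) (infinitePi_cylinderOf_ne_zero (by simpa using hy))]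
    with ω hω
  simp only [even_partialSum_iff 0]
  -- If the sums were eventually odd, the odd step `y` would still occur after infinitely many of
  -- them and make the next sum even.
  by_contra hc
  rw [not_frequently] at hc
  have h1 : ∃ᶠ n in atTop, ω ∈ {ω | walk Y 0 n ω % 2 = 1} :=
    (hc.mono fun n hn => by simp only [mem_ofPred_eq]; omega).frequently
  obtain ⟨n, ⟨h2, h3⟩, h4⟩ :=
    ((hω h1).and_eventually ((tendsto_add_atTop_nat 1).eventually hc)).exists
  have h5 : Y (n + 1) ω = y := by simpa [cylinderOf] using h3
  apply h4
  rw [walk, h5]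
  obtain ⟨c, rfl⟩ := hodd
  omega

lemma measurable_partialSum (hmeas : ∀ n, Measurable (Y n)) (n : ℕ) :
    Measurable (partialSum Y n) := by
  unfold partialSum
  exact Finset.measurable_sum _ fun k _ => hmeas k

lemma measurableSet_lt_returnTime (hmeas : ∀ n, Measurable (Y n)) (x k : ℕ) :
    MeasurableSet[stepFiltration hmeas k]
      {ω | (k : ℕ∞) < returnTime (fun n => walk Y x n ω) x} := by
  have : {ω | (k : ℕ∞) < returnTime (fun n => walk Y x n ω) x} =
      ⋂ j ∈ Finset.Icc 1 k, (walk Y x j) ⁻¹' {x}ᶜ := by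
    ext ω
    simp only [mem_ofPred_eq, lt_returnTime_iff, mem_iInter, Finset.mem_Icc, mem_preimage,
      mem_compl_iff, mem_singleton_iff, and_imp]
    refine forall₂_congr fun j _ => ⟨fun h h1 h2 => ?_, fun h h1 => ?_⟩
    · exact absurd (h h2) (by omega)
    · by_contra h2
      exact h (by omega) h1
  rw [this]
  refine Finset.measurableSet_biInter _ fun j hj => ?_
  exact (stepFiltration hmeas).mono (Finset.mem_Icc.1 hj).2 _
    (measurable_walk_filtration hmeas x j (measurableSet_singleton x).compl)

open Classical in
/-- The mean return time of the walk is finite if that of the induced walk is finite. -/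
theorem IsStepSequence.lintegral_returnTime_lt_top (hY : IsStepSequence P μ Y)
    (hμ : IsAdmissible μ) (x : ℕ)
    (hrec : ∀ᵐ ω ∂P, returnTime (fun n => walk Y x n ω) x < ⊤)
    (hfin : ∫⁻ ω, (returnTime (fun n => inducedWalk Y x n ω) x : ℝ≥0∞) ∂P < ∞) :
    ∫⁻ ω, (returnTime (fun n => walk Y x n ω) x : ℝ≥0∞) ∂P < ∞ := by
  set a := ∫⁻ ω, (returnTime (fun n => inducedWalk Y x n ω) x : ℝ≥0∞) ∂P
  obtain ⟨y, hy, hodd⟩ := hμ.exists_odd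
  let U : ℕ → Set Ω := fun k => {ω | (k : ℕ∞) < returnTime (fun n => walk Y x n ω) x}
  let E : ℕ → Set Ω := fun k => {ω | Even (partialSum Y k ω)}
  let B : ℕ → Set Ω := fun k => (fun ω j => Y (k + 1 + j) ω) ⁻¹' cylinderOf [y]
  have hUF : ∀ k, MeasurableSet[stepFiltration hY.measurable k] (U k) :=
    measurableSet_lt_returnTime hY.measurable x
  have hU : ∀ k, MeasurableSet (U k) := fun k => (stepFiltration hY.measurable).le k _ (hUF k)
  have hEF : ∀ k, MeasurableSet[stepFiltration hY.measurable k] (E k) := fun k => by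
    have : E k = walk Y 0 k ⁻¹' {j | j % 2 = 0} := by
      ext ω; simp only [E, mem_ofPred_eq, even_partialSum_iff 0, mem_preimage]
    rw [this]
    exact measurable_walk_filtration hY.measurable 0 k .of_discrete
  have hE : ∀ k, MeasurableSet (E k) := fun k => (stepFiltration hY.measurable).le k _ (hEF k)
  have hB : ∀ k, MeasurableSet (B k) := fun k =>
    measurable_shift hY.measurable k (measurableSet_cylinderOf [y])
  set p := Measure.infinitePi (fun _ : ℕ => μ) (cylinderOf [y]) with hp
  have hp0 : p ≠ 0 := infinitePi_cylinderOf_ne_zero (by simpa using hy)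
  have hPB : ∀ k, P (B k) = p := fun k => by
    rw [hp, ← map_shift hY.measurable hY.indep hY.law k,
      Measure.map_apply (measurable_shift hY.measurable k) (measurableSet_cylinderOf [y])]
  -- Not having returned by time `k` with an odd sum depends on the past only, hence is independent
  -- of the next step being `y`. That step makes the sum even, so `tsum_even_succ_le` applies below.
  have hmul : ∀ k, P (U k ∩ (E k)ᶜ) * p = P (B k ∩ (U k ∩ (E k)ᶜ)) := fun k => by
    rw [← hPB k, mul_comm]
    exact ((Indep_iff _ _ P).1 (indep_shift hY.measurable hY.indep k) _ _
      ⟨_, measurableSet_cylinderOf [y], rfl⟩ ((hUF k).inter (hEF k).compl)).symm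
  have heven := hY.ae_frequently_even hμ
  have h1 : ∑' k, P (U k ∩ E k) ≤ a := by
    simp_rw [fun k => (lintegral_indicator_one (μ := P) ((hU k).inter (hE k))).symm]
    rw [← lintegral_tsum fun k =>
      (measurable_one.indicator ((hU k).inter (hE k))).aemeasurable]
    refine lintegral_mono_ae ?_
    filter_upwards [heven] with ω hω
    refine (ENNReal.tsum_le_tsum fun k => ?_).trans (tsum_even_le hω x)
    simp [U, E, indicator_apply]
  have h2 : (∑' k, P (U k ∩ (E k)ᶜ)) * p ≤ a := by
    rw [← ENNReal.tsum_mul_right]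
    simp_rw [hmul]
    have hm : ∀ k, MeasurableSet (B k ∩ (U k ∩ (E k)ᶜ)) := fun k =>
      (hB k).inter ((hU k).inter (hE k).compl)
    simp_rw [fun k => (lintegral_indicator_one (μ := P) (hm k)).symm]
    rw [← lintegral_tsum fun k => (measurable_one.indicator (hm k)).aemeasurable]
    refine lintegral_mono_ae ?_
    filter_upwards [heven] with ω hω
    refine (ENNReal.tsum_le_tsum fun k => ?_).trans (tsum_even_succ_le hω x)
    rw [indicator_apply]
    split_ifs with h3 h4 h4
    · simp
    · refine absurd ⟨h3.2.1, ?_⟩ h4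
      have h5 : Y (k + 1) ω = y := by simpa [B, cylinderOf] using h3.1
      have h6 : ¬ Even (partialSum Y k ω) := h3.2.2
      rw [partialSum, Finset.sum_Icc_succ_top (by omega), h5]
      exact (Int.not_even_iff_odd.1 h6).add_odd hodd
    · simp
    · simp
  have h3 : ∑' k, P (U k ∩ (E k)ᶜ) < ∞ := by
    by_contra h
    rw [not_lt_top_iff.1 h, ENNReal.top_mul hp0] at h2
    exact absurd hfin (not_lt.2 h2)
  calc ∫⁻ ω, (returnTime (fun n => walk Y x n ω) x : ℝ≥0∞) ∂P
      ≤ ∫⁻ ω, ∑' k, (U k).indicator 1 ω ∂P := by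
        refine lintegral_mono_ae ?_
        filter_upwards [hrec] with ω hω
        obtain ⟨n, -, -, hn⟩ := exists_of_returnTime_lt_top hω
        refine le_trans ?_ (ENNReal.sum_le_tsum (Finset.range n))
        rw [Finset.sum_congr rfl fun k hk => indicator_of_mem (s := U k) (a := ω) (by
          simp only [U, mem_ofPred_eq, hn]
          exact_mod_cast Finset.mem_range.1 hk) 1]
        simp [hn]
    _ = ∑' k, (P (U k ∩ E k) + P (U k ∩ (E k)ᶜ)) := by
        rw [lintegral_tsum fun k => (measurable_one.indicator (hU k)).aemeasurable]
        refine tsum_congr fun k => ?_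
        rw [lintegral_indicator_one (hU k), ← sdiff_eq, measure_inter_add_sdiff _ (hE k)]
    _ = ∑' k, P (U k ∩ E k) + ∑' k, P (U k ∩ (E k)ᶜ) := ENNReal.tsum_add
    _ < ∞ := ENNReal.add_lt_top.2 ⟨h1.trans_lt hfin, h3⟩

end Walk

end ReflectedWalk

/-! ### The induced process: invariant sets, contractivity, attractor, recurrence -/

namespace ReflectedWalk

lemma mem_parityClass {i : Fin 2} {x : ℕ} : x ∈ parityClass i ↔ x % 2 = i := Iff.rfl

lemma IsAdmissible.val_mem_inter {μ : Measure ℤ} (hμ : IsAdmissible μ) (i : Fin 2) :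
    (i : ℕ) ∈ essentialClass μ ∩ parityClass i := by
  refine ⟨?_, mem_parityClass.2 (Nat.mod_eq_of_lt i.2)⟩
  fin_cases i
  · exact zero_mem_essentialClass
  · exact hμ.one_mem_essentialClass

lemma run_take_add_drop (x k : ℕ) (w : List ℤ) : run (run x (w.take k)) (w.drop k) = run x w := by
  rw [← run_append, List.take_append_drop]

lemma path_eq_run_take {w : List ℤ} {s : ℕ → ℤ} (hs : s ∈ cylinderOf w) (x : ℕ) {k : ℕ}
    (hk : k ≤ w.length) : path x s k = run x (w.take k) := by
  have hlen : (w.take k).length = k := by simpa using hk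
  have := path_length_eq_run (w.take k) x s fun j hj => by
    rw [hlen] at hj
    rw [hs j (hj.trans_le hk), List.getD_eq_getElem _ _ (hj.trans_le hk),
      List.getD_eq_getElem _ _ (by omega), List.getElem_take]
  rwa [hlen] at this

section Walk

variable {Ω : Type*} [MeasurableSpace Ω] {P : Measure Ω} {μ : Measure ℤ} {Y : ℕ → Ω → ℤ}

lemma measurable_evenTime_one (hmeas : ∀ n, Measurable (Y n)) : Measurable (evenTime Y 1) := by
  have hE : ∀ k, MeasurableSet {ω | Even (partialSum Y k ω)} := fun k =>
    measurable_partialSum hmeas k (MeasurableSet.of_discrete (s := {j | Even j}))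
  refine measurable_of_Iio fun n => ?_
  -- The second set accounts for the default value `0` when no positive time is even.
  have : evenTime Y 1 ⁻¹' Iio n =
      (⋃ k ∈ Ioo 0 n, {ω | Even (partialSum Y k ω)}) ∪
        ((⋂ k ∈ Ioi 0, {ω | Even (partialSum Y k ω)}ᶜ) ∩ {_ω | 0 < n}) := by
    ext ω
    simp only [mem_preimage, mem_Iio, evenTime, mem_union, mem_iUnion, mem_Ioo, mem_inter_iff,
      mem_iInter, mem_Ioi, mem_compl_iff, mem_ofPred_eq, exists_prop]
    by_cases hne : {k : ℕ | 0 < k ∧ Even (partialSum Y k ω)}.Nonempty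
    · constructor
      · intro h
        have hmem := Nat.sInf_mem hne
        exact Or.inl ⟨_, ⟨hmem.1, h⟩, hmem.2⟩
      · rintro (⟨k, ⟨h1, h2⟩, h3⟩ | ⟨h1, -⟩)
        · exact lt_of_le_of_lt (Nat.sInf_le (by exact ⟨h1, h3⟩)) h2
        · obtain ⟨k, h2, h3⟩ := hne
          exact absurd h3 (h1 k h2)
    · have hempty := not_nonempty_iff_eq_empty.1 hne
      rw [hempty, Nat.sInf_empty]
      constructor
      · intro h
        exact Or.inr ⟨fun k h1 h2 => hne ⟨k, h1, h2⟩, h⟩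
      · rintro (⟨k, ⟨h1, h2⟩, h3⟩ | ⟨-, h1⟩)
        · exact (hne (Exists.intro k ⟨h1, h3⟩)).elim
        · exact h1
  rw [this]
  refine .union (.biUnion (to_countable _) fun k _ => hE k) (.inter ?_ (.const _))
  exact .biInter (to_countable _) fun k _ => (hE k).compl

lemma measurable_inducedWalk_one (hmeas : ∀ n, Measurable (Y n)) :
    Measurable (fun ω x => inducedWalk Y x 1 ω) := by
  refine measurable_pi_lambda _ fun x => measurable_to_countable' fun z => ?_
  have : (fun ω => inducedWalk Y x 1 ω) ⁻¹' {z} =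
      ⋃ k, evenTime Y 1 ⁻¹' {k} ∩ walk Y x k ⁻¹' {z} := by
    ext ω; simp [inducedWalk]
  rw [this]
  exact .iUnion fun k => (measurable_evenTime_one hmeas (measurableSet_singleton k)).inter
    (measurable_walk (fun j _ => hmeas j) x (measurableSet_singleton z))

variable [IsProbabilityMeasure μ]

/-- With positive probability the first steps spell `w`. Then `t(1)` is the length of `w`, no
earlier nonempty prefix having an even sum, and the induced map is exactly that of `w`. -/
lemma IsStepSequence.run_mem_support_inducedLaw (hY : IsStepSequence P μ Y) {w : List ℤ}
    (hw : ∀ s ∈ w, s ∈ μ.support) (hne : w ≠ []) (hev : Even w.sum)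
    (hodd : ∀ k, 0 < k → k < w.length → ¬ Even (w.take k).sum) :
    (fun x => run x w) ∈ (inducedLaw P Y).support := by
  rw [Measure.mem_support_iff_forall]
  intro U hU
  have hmeas := (measurable_inducedWalk_one hY.measurable).aemeasurable (μ := P)
  have hpos : 0 < P ((fun ω j => Y (0 + 1 + j) ω) ⁻¹' cylinderOf w) := by
    rw [← Measure.map_apply (measurable_shift hY.measurable 0) (measurableSet_cylinderOf w),
      map_shift hY.measurable hY.indep hY.law]
    exact pos_iff_ne_zero.2 (infinitePi_cylinderOf_ne_zero hw)
  refine hpos.trans_le ((measure_mono fun ω hω => ?_).trans (Measure.le_map_apply hmeas U))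
  have hwalk : ∀ x, ∀ k ≤ w.length, walk Y x k ω = run x (w.take k) := fun x k hk => by
    rw [walk_eq_path]
    simp only [add_comm _ 1]
    exact path_eq_run_take (by simpa using hω) x hk
  have heven : ∀ k ≤ w.length, (Even (partialSum Y k ω) ↔ Even (w.take k).sum) := fun k hk => by
    rw [even_partialSum_iff 0, hwalk 0 k hk, Int.even_iff]
    have := run_emod_two (w.take k) 0
    omega
  have ht : evenTime Y 1 ω = w.length := by
    have hmem : w.length ∈ {k : ℕ | evenTime Y 0 ω < k ∧ Even (partialSum Y k ω)} := by
      refine ⟨List.length_pos_iff.2 hne, (heven _ le_rfl).2 (by simpa using hev)⟩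
    refine le_antisymm (Nat.sInf_le hmem) (le_csInf ⟨_, hmem⟩ ?_)
    rintro k ⟨hk0, hk⟩
    by_contra! hlt
    exact hodd k hk0 hlt ((heven k hlt.le).1 hk)
  have : (fun x => inducedWalk Y x 1 ω) = fun x => run x w := by
    funext x
    rw [inducedWalk, ht, hwalk x _ le_rfl, List.take_length]
  rw [mem_preimage, this]
  exact mem_of_mem_nhds hU

/-- A word with even sum splits at its even prefixes into words that each realise one map in the
support; cut at the first and induct on the length. -/
lemma IsStepSequence.run_mem_of_mapsTo (hY : IsStepSequence P μ Y) {A : Set ℕ}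
    (hA : ∀ f ∈ (inducedLaw P Y).support, MapsTo f A A) {w : List ℤ}
    (hw : ∀ s ∈ w, s ∈ μ.support) (hev : Even w.sum) {a : ℕ} (ha : a ∈ A) : run a w ∈ A := by
  induction hn : w.length using Nat.strong_induction_on generalizing w a with
  | _ n ih =>
    rcases eq_or_ne w [] with rfl | hne
    · exact ha
    have hex : ∃ k, 0 < k ∧ k ≤ w.length ∧ Even (w.take k).sum :=
      ⟨w.length, List.length_pos_iff.2 hne, le_rfl, by simpa using hev⟩
    classical
    obtain ⟨h0, hle, hk⟩ := Nat.find_spec hex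
    set k := Nat.find hex
    have hlen : (w.take k).length = k := by simpa using hle
    rw [← run_take_add_drop a k w]
    refine ih (w.drop k).length (by rw [List.length_drop]; omega)
      (fun s hs => hw s (List.mem_of_mem_drop hs)) ?_ ?_ rfl
    · have h1 : (w.take k).sum + (w.drop k).sum = w.sum := List.sum_take_add_sum_drop w k
      rw [← h1] at hev
      exact (Int.even_add.1 hev).1 hk
    · refine hA _ (hY.run_mem_support_inducedLaw
        (fun s hs => hw s (List.mem_of_mem_take hs)) ?_ hk ?_) ha
      · intro h
        rw [h] at hlen
        simp at hlen
        omega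
      · intro j hj0 hj hje
        rw [hlen] at hj
        rw [List.take_take, min_eq_left hj.le] at hje
        exact Nat.find_min hex hj ⟨hj0, hj.le.trans hle, hje⟩

variable [IsProbabilityMeasure P]

/-- The induced process is locally contractive on each parity class. -/
theorem IsStepSequence.locallyContractiveOn (hY : IsStepSequence P μ Y) (hμ : IsAdmissible μ)
    (i : Fin 2) : LocallyContractiveOn P (inducedWalk Y) (parityClass i) := by
  intro x hx K hK hKc
  have hc : ∀ᵐ ω ∂P, ∀ y z, x % 2 = y % 2 → (∃ᶠ n in atTop, walk Y x n ω = z) →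
      ∀ᶠ n in atTop, walk Y x n ω = walk Y y n ω :=
    ae_all_iff.2 fun y => ae_all_iff.2 fun z => ae_all_iff.2 fun h => hY.ae_coalesce hμ x y z h
  filter_upwards [hY.ae_frequently_even hμ, hc] with ω hω hc y hy
  rw [mem_parityClass] at hx hy
  refine tendsto_const_nhds.congr' ?_
  -- Either a point of `K` recurs and the trajectories coalesce, or the finite set `K` is eventually
  -- left and the indicator vanishes.
  by_cases h : ∃ z ∈ K, ∃ᶠ n in atTop, inducedWalk Y x n ω = z
  · obtain ⟨z, hzK, hz⟩ := h
    rw [frequently_inducedWalk_iff hω ((mem_parityClass.1 (hK hzK)).trans hx.symm)] at hz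
    filter_upwards [(strictMono_evenTime hω).tendsto_atTop.eventually
      (hc y z (hx.trans hy.symm) hz)] with n hn
    simp only [inducedWalk, hn, dist_self, zero_mul]
  · push Not at h
    filter_upwards [(eventually_all_finite (isCompact_iff_finite.1 hKc)).2 h] with n hn
    rw [indicator_of_notMem fun hmem => hn _ hmem rfl, mul_zero]

lemma IsStepSequence.ae_inducedWalk_mem (hY : IsStepSequence P μ Y) (hμ : IsAdmissible μ) :
    ∀ᵐ ω ∂P, ∀ i, ∀ x ∈ essentialClass μ ∩ parityClass i, ∀ n,
      inducedWalk Y x n ω ∈ essentialClass μ ∩ parityClass i := by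
  filter_upwards [hY.ae_frequently_even hμ, hY.ae_mem_essentialClass] with ω hω hL i x hx n
  exact ⟨hL x 0 _ hx.1 (Nat.zero_le _), (inducedWalk_mod_two hω x n).trans hx.2⟩

/-- The essential class is the least invariant set of the induced process on a parity class. -/
theorem IsStepSequence.isLeastInvariant (hY : IsStepSequence P μ Y) (hμ : IsAdmissible μ)
    (i : Fin 2) :
    IsLeastInvariant (inducedLaw P Y) (parityClass i) (essentialClass μ ∩ parityClass i) := by
  refine ⟨⟨inter_subset_right, ⟨i, hμ.val_mem_inter i⟩, isClosed_discrete _, ?_⟩, ?_⟩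
  · intro f hf x hx
    have hev : (fun g : ℕ → ℕ => g x) ⁻¹' {f x} = {g | g x = f x} := rfl
    -- Agreement with `f` at the single point `x` is an open condition, hence has positive mass, and
    -- a typical outcome realises the value `f x`.
    have hU : {g : ℕ → ℕ | g x = f x} ∈ 𝓝 f :=
      hev ▸ ((isOpen_discrete {f x}).preimage (continuous_apply x)).mem_nhds rfl
    have hm : MeasurableSet {g : ℕ → ℕ | g x = f x} :=
      hev ▸ measurable_pi_apply x (measurableSet_singleton (f x))
    have hpos := (Measure.mem_support_iff_forall _).1 hf _ hU
    rw [inducedLaw, Measure.map_apply (measurable_inducedWalk_one hY.measurable) hm] at hpos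
    obtain ⟨ω, h1, h2⟩ := ((frequently_ae_iff.2 hpos.ne').and_eventually
      (hY.ae_inducedWalk_mem hμ)).exists
    have h3 : inducedWalk Y x 1 ω = f x := h1
    exact h3 ▸ h2 i x hx 1
  · rintro A ⟨hAC, ⟨a, ha⟩, -, hA⟩ z ⟨hzL, hz⟩
    obtain ⟨w, hw, rfl⟩ := hμ.exists_run_eq a hzL
    refine hY.run_mem_of_mapsTo hA hw ?_ ha
    have h1 := run_emod_two w a
    have h2 := mem_parityClass.1 (hAC ha)
    have h3 := mem_parityClass.1 hz
    rw [Int.even_iff]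
    omega

/-- If some point is almost surely visited infinitely often from itself, then each point of the
essential class with the same parity as the starting point is almost surely visited infinitely
often. -/
theorem IsStepSequence.ae_frequently_of_self (hY : IsStepSequence P μ Y) (hμ : IsAdmissible μ)
    {z : ℕ} (h : ∀ᵐ ω ∂P, ∃ᶠ n in atTop, walk Y z n ω = z) {x u : ℕ} (hx : x % 2 = z % 2)
    (hu : u ∈ essentialClass μ) : ∀ᵐ ω ∂P, ∃ᶠ n in atTop, walk Y x n ω = u := by
  obtain ⟨w, hw, rfl⟩ := hμ.exists_run_eq z hu
  filter_upwards [h, hY.ae_coalesce hμ z x z hx.symm, hY.ae_frequently_run x x z z hw]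
    with ω h1 h2 h3
  have h4 : ∃ᶠ n in atTop, walk Y x n ω = z :=
    (h1.and_eventually (h2 h1)).mono fun n hn => hn.2 ▸ hn.1
  exact (h3 (h4.mono fun n hn => ⟨hn, hn⟩)).mono fun n hn => hn.1

/-- The essential class is the attractor of the induced process, unless that is transient. -/
theorem IsStepSequence.isAttractor (hY : IsStepSequence P μ Y) (hμ : IsAdmissible μ) (i : Fin 2)
    (ht : ¬ TransientOn P (inducedWalk Y) (parityClass i)) :
    IsAttractor P (inducedWalk Y) (parityClass i) (essentialClass μ ∩ parityClass i) := by
  have heven := hY.ae_frequently_even hμ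
  -- If almost surely no point recurred, every bounded set would eventually be left, which is
  -- transience.
  obtain ⟨x, z, hx, hz, hpos⟩ : ∃ x z, x % 2 = (i : ℕ) ∧ z % 2 = (i : ℕ) ∧
      ¬ ∀ᵐ ω ∂P, ¬ ∃ᶠ n in atTop, walk Y x n ω = z := by
    by_contra! hc
    refine ht fun x hx => ?_
    have hc' : ∀ᵐ ω ∂P, ∀ z, z % 2 = (i : ℕ) → ¬ ∃ᶠ n in atTop, walk Y x n ω = z :=
      ae_all_iff.2 fun z => ae_all_iff.2 fun hz => by
        simpa only [not_frequently] using hc x z hx hz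
    filter_upwards [heven, hc'] with ω hω hc'
    have h1 : Tendsto (fun n => inducedWalk Y x n ω) atTop atTop := by
      rw [tendsto_atTop]
      intro b
      have h2 : ∀ z ∈ Iio b, ∀ᶠ n in atTop, inducedWalk Y x n ω ≠ z := fun z _ => by
        rw [← not_frequently]
        intro hf
        obtain ⟨n, hn⟩ := hf.exists
        have hz : z % 2 = x % 2 := hn ▸ inducedWalk_mod_two hω x n
        exact hc' z (hz.trans hx) ((frequently_inducedWalk_iff hω hz).1 hf)
      filter_upwards [(eventually_all_finite (finite_Iio b)).2 h2] with n hn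
      exact not_lt.1 fun hlt => hn _ hlt rfl
    refine tendsto_atTop_mono (fun n => ?_)
      (tendsto_atTop_add_const_right atTop (-(x : ℝ)) (tendsto_natCast_atTop_atTop.comp h1))
    rw [Nat.dist_eq]
    exact le_abs_self _
  have hself := hY.ae_frequently_self hpos
  have hvis : ∀ y ∈ parityClass i, ∀ u ∈ essentialClass μ ∩ parityClass i,
      ∀ᵐ ω ∂P, ∃ᶠ n in atTop, inducedWalk Y y n ω = u := fun y hy u hu => by
    filter_upwards [heven, hY.ae_frequently_of_self hμ hself
      ((mem_parityClass.1 hy).trans hz.symm) hu.1] with ω h1 h2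
    exact (frequently_inducedWalk_iff h1 (hu.2.trans (mem_parityClass.1 hy).symm)).2 h2
  refine ⟨⟨⟨inter_subset_right, ⟨i, hμ.val_mem_inter i⟩, isClosed_discrete _, ?_⟩, ?_⟩, ?_⟩
  · rintro U - ⟨u, huU, hu⟩ y hy
    filter_upwards [hvis y hy u hu] with ω hω
    exact hω.mono fun n hn => hn ▸ huU
  · rintro A ⟨hAC, -, -, hA⟩ a ha
    -- The start `i` lies in the essential class, which is never left, so any point visited from
    -- there belongs to it.
    have h1 := hA {a} (isOpen_discrete _) ⟨a, rfl, ha⟩ i (hμ.val_mem_inter i).2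
    obtain ⟨ω, h2, h3⟩ := (h1.and (hY.ae_inducedWalk_mem hμ)).exists
    obtain ⟨n, hn⟩ := h2.exists
    exact (mem_singleton_iff.1 hn) ▸ h3 i i (hμ.val_mem_inter i) n
  · intro y hy
    have hvis' : ∀ᵐ ω ∂P, ∀ u ∈ essentialClass μ ∩ parityClass i,
        ∃ᶠ n in atTop, inducedWalk Y y n ω = u :=
      ae_all_iff.2 fun u => ae_all_iff.2 fun hu => hvis y hy u hu
    filter_upwards [heven, hvis', hY.ae_mem_essentialClass] with ω h1 h2 h3
    ext u
    have hiff : MapClusterPt u atTop (fun n => inducedWalk Y y n ω) ↔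
        ∃ᶠ n in atTop, inducedWalk Y y n ω = u := by
      rw [mapClusterPt_iff_frequently, nhds_discrete]
      exact ⟨fun h => h {u} rfl, fun h s hs => h.mono fun n hn => hn ▸ hs⟩
    rw [mem_ofPred_eq, hiff]
    refine ⟨fun hu => ?_, h2 u⟩
    obtain ⟨n, hn⟩ := (h2 i (hμ.val_mem_inter i)).exists
    obtain ⟨m, hm, hmu⟩ := frequently_atTop.1 hu n
    refine ⟨?_, ?_⟩
    · rw [← hmu]
      refine h3 y _ _ ?_ ((strictMono_evenTime h1).monotone hm)
      exact (show walk Y y (evenTime Y n ω) ω = i from hn) ▸ (hμ.val_mem_inter i).1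
    · rw [← hmu]
      exact (inducedWalk_mod_two h1 y m).trans hy

/-- If the walk is recurrent, then the induced process is recurrent. -/
theorem IsStepSequence.recurrentOn_inducedWalk (hY : IsStepSequence P μ Y)
    (hμ : IsAdmissible μ) (h : RecurrentOn P (walk Y) (essentialClass μ)) (i : Fin 2) :
    RecurrentOn P (inducedWalk Y) (essentialClass μ ∩ parityClass i) := by
  intro x hx
  filter_upwards [hY.ae_frequently_even hμ, h x hx.1] with ω h1 h2
  exact (returnTime_inducedWalk_le h1 x).trans_lt h2

/-- If the walk is positive recurrent, then the induced process is positive recurrent. -/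
theorem IsStepSequence.positiveRecurrentOn_inducedWalk (hY : IsStepSequence P μ Y)
    (hμ : IsAdmissible μ) (h : PositiveRecurrentOn P (walk Y) (essentialClass μ)) (i : Fin 2) :
    PositiveRecurrentOn P (inducedWalk Y) (essentialClass μ ∩ parityClass i) := by
  refine ⟨hY.recurrentOn_inducedWalk hμ h.1 i, fun x hx => ?_⟩
  refine (lintegral_mono_ae ?_).trans_lt (h.2 x hx.1)
  filter_upwards [hY.ae_frequently_even hμ] with ω hω
  exact ENat.toENNReal_le.2 (returnTime_inducedWalk_le hω x)

/-- If the walk is null recurrent, then the induced process is null recurrent. -/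
theorem IsStepSequence.nullRecurrentOn_inducedWalk (hY : IsStepSequence P μ Y)
    (hμ : IsAdmissible μ) (h : NullRecurrentOn P (walk Y) (essentialClass μ)) (i : Fin 2) :
    NullRecurrentOn P (inducedWalk Y) (essentialClass μ ∩ parityClass i) := by
  refine ⟨hY.recurrentOn_inducedWalk hμ h.1 i, fun x hx => ?_⟩
  by_contra hne
  exact (hY.lintegral_returnTime_lt_top hμ x (h.1 x hx.1) (lt_top_iff_ne_top.2 hne)).ne
    (h.2 x hx.1)

/-- If the walk is recurrent, then trajectories whose starting points have the same parity
coalesce. -/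
theorem IsStepSequence.tendsto_walk_sub_walk (hY : IsStepSequence P μ Y) (hμ : IsAdmissible μ)
    (h : RecurrentOn P (walk Y) (essentialClass μ)) {x y : ℕ} (hxy : x % 2 = y % 2) :
    ∀ᵐ ω ∂P, Tendsto (fun n => (walk Y x n ω : ℝ) - (walk Y y n ω : ℝ)) atTop (𝓝 0) := by
  -- The starting points may lie outside the essential class; `0` or `1` serves as a recurrent point
  -- of their parity.
  have hz : x % 2 ∈ essentialClass μ := by
    rcases Nat.mod_two_eq_zero_or_one x with h0 | h0 <;> rw [h0]
    · exact zero_mem_essentialClass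
    · exact hμ.one_mem_essentialClass
  have hself := hY.ae_frequently_of_ae_exists (z := x % 2) <| (h _ hz).mono fun ω hω => by
    obtain ⟨n, h1, h2, -⟩ := exists_of_returnTime_lt_top hω
    exact ⟨n, h1, h2⟩
  filter_upwards [hY.ae_frequently_of_self hμ hself (x := x) (by omega) hz,
    hY.ae_coalesce hμ x y (x % 2) hxy] with ω h1 h2
  refine tendsto_const_nhds.congr' ?_
  filter_upwards [h2 h1] with n hn
  rw [hn, sub_self]

end Walk

end ReflectedWalk

theorem mainTheorem4 {Ω : Type*} [MeasurableSpace Ω] (P : Measure Ω) [IsProbabilityMeasure P]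
    (μ : Measure ℤ) [IsProbabilityMeasure μ]
    (hpos : 0 < μ (Set.Ioi 0))
    (hgcd : ∀ d : ℕ, (∀ k ∈ μ.support, (d : ℤ) ∣ k) → d = 1)
    (Y : ℕ → Ω → ℤ) (hmeas : ∀ n, Measurable (Y n)) (hindep : iIndepFun Y P)
    (hlaw : ∀ n, P.map (Y n) = μ) :
    (∀ i : Fin 2,
      ReflectedWalk.LocallyContractiveOn P (ReflectedWalk.inducedWalk Y)
        (ReflectedWalk.parityClass i) ∧
      ReflectedWalk.IsLeastInvariant (ReflectedWalk.inducedLaw P Y)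
        (ReflectedWalk.parityClass i)
        (ReflectedWalk.essentialClass μ ∩ ReflectedWalk.parityClass i) ∧
      (¬ ReflectedWalk.TransientOn P (ReflectedWalk.inducedWalk Y)
          (ReflectedWalk.parityClass i) →
        ReflectedWalk.IsAttractor P (ReflectedWalk.inducedWalk Y)
          (ReflectedWalk.parityClass i)
          (ReflectedWalk.essentialClass μ ∩ ReflectedWalk.parityClass i))) ∧
    (ReflectedWalk.PositiveRecurrentOn P (ReflectedWalk.walk Y)
        (ReflectedWalk.essentialClass μ) →
      ∀ i : Fin 2, ReflectedWalk.PositiveRecurrentOn P (ReflectedWalk.inducedWalk Y)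
        (ReflectedWalk.essentialClass μ ∩ ReflectedWalk.parityClass i)) ∧
    (ReflectedWalk.NullRecurrentOn P (ReflectedWalk.walk Y)
        (ReflectedWalk.essentialClass μ) →
      ∀ i : Fin 2, ReflectedWalk.NullRecurrentOn P (ReflectedWalk.inducedWalk Y)
        (ReflectedWalk.essentialClass μ ∩ ReflectedWalk.parityClass i)) ∧
    (ReflectedWalk.RecurrentOn P (ReflectedWalk.walk Y) (ReflectedWalk.essentialClass μ) →
      ∀ x y : ℕ, Even ((x : ℤ) - (y : ℤ)) → ∀ᵐ ω ∂P,
        Tendsto (fun n => (ReflectedWalk.walk Y x n ω : ℝ) - (ReflectedWalk.walk Y y n ω : ℝ))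
          atTop (𝓝 0)) := by
  have hY : ReflectedWalk.IsStepSequence P μ Y := ⟨hmeas, hindep, hlaw⟩
  have hμ : ReflectedWalk.IsAdmissible μ := ⟨hpos, hgcd⟩
  refine ⟨fun i => ⟨hY.locallyContractiveOn hμ i, hY.isLeastInvariant hμ i,
    hY.isAttractor hμ i⟩, hY.positiveRecurrentOn_inducedWalk hμ,
    hY.nullRecurrentOn_inducedWalk hμ, fun h x y hxy => ?_⟩
  refine hY.tendsto_walk_sub_walk hμ h ?_
  rw [Int.even_iff] at hxy
  omega
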